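/- Let $-\infty<a<b<\infty$, $n\in\mathbb N$, and let $K:[a,b]\times[a,b]\to\mathbb C^{n\times n}$ be continuous. For $\xi\in[a,b]$ consider the truncated matrix equations on $[a,\xi]$, with continuous $n\times n$ matrix unknowns $g(\cdot,\xi)$ and $g^*(\cdot,\xi)$, $$g(t,\xi)-\int_a^\xi K(t,s)\,g(s,\xi)\,ds=I,\qquad g^*(t,\xi)-\int_a^\xi g^*(s,\xi)\,K(s,t)\,ds=I\qquad(a\le t\le\xi)$$ (for $\xi=a$ they just say $g(a,a)=g^*(a,a)=I$). Suppose that for every $\xi\in(a,b]$ the first equation has a unique continuous solution $g(\cdot,\xi)$. Then for every $\xi\in(a,b]$ the second equation also has a unique continuous solution $g^*(\cdot,\xi)$. Suppose moreover that $\det[g^*(\xi,\xi)\,g(\xi,\xi)]\ne0$ for all $\xi\in[a,b]$, and put $M(\xi)=\int_a^\xi g(t,\xi)\,dt$. Then $M$ is differentiable on $[a,b]$ (one-sidedly at the endpoints, as for all derivatives below) and $M'(\xi)$ is invertible for every $\xi\in[a,b]$. For every continuous $f:[a,b]\to\mathbb C^n$ the function $\xi\mapsto\int_a^\xi g^*(s,\xi)f(s)\,ds$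 is differentiable on $[a,b]$, and, with $$F(\xi)=[M'(\xi)]^{-1}\,\frac{d}{d\xi}\int_a^\xi g^*(s,\xi)f(s)\,ds ,$$ the system $$\varphi(t)-\int_a^bK(t,s)\varphi(s)\,ds=f(t)\qquad(a\le t\le b)$$ has a unique continuous solution $\varphi$, given for all $t\in[a,b]$ by $$\varphi(t)=g(t,b)\,[M'(b)]^{-1}\Bigl[\frac{d}{d\xi}\int_a^\xi g^*(s,\xi)f(s)\,ds\Bigr]_{\xi=b}-\int_t^b g(t,\xi)\,dF(\xi),$$ where the last integral exists as a Riemann–Stieltjes integral (limit of the sums $\sum_i g(t,\tau_i)(F(x_{i+1})-F(x_i))$ over tagged partitions of $[t,b]$ as the mesh tends to $0$). If $F$ is absolutely continuous on $[a,b]$, then $F$ is differentiable almost everywhere on $[a,b]$, the function $\xi\mapsto g(t,\xi)\frac{d}{d\xi}F(\xi)$ is integrable on $[t,b]$ for every $t\in[a,b]$, and the last integral may be written $\int_t^b g(t,\xi)\,\frac{d}{d\xi}F(\xi)\,d\xi$, i.e. $$\varphi(t)=g(t,b)\,[M'(b)]^{-1}\Bigl[\frac{d}{d\xi}\int_a^\xi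 g^*(s,\xi)f(s)\,ds\Bigr]_{\xi=b}-\int_t^b g(t,\xi)\,\frac{d}{d\xi}\Bigl\{[M'(\xi)]^{-1}\frac{d}{d\xi}\int_a^\xi g^*(s,\xi)f(s)\,ds\Bigr\}d\xi .$$ -/

import Mathlib

open Set MeasureTheory
open scoped Matrix Matrix.Norms.L2Operator

noncomputable section

namespace KreinSystem

variable {n : ℕ}

/-- `φ` is a continuous solution on `[a,b]` of `φ(t) - ∫_a^b K(t,s) φ(s) ds = f(t)`. -/
def IsSystemSol (K : ℝ → ℝ → Matrix (Fin n) (Fin n) ℂ) (a b : ℝ) (f φ : ℝ → Fin n → ℂ) : Prop :=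
  ContinuousOn φ (Icc a b) ∧
    ∀ t ∈ Icc a b, φ t - ∫ s in a..b, K t s *ᵥ φ s = f t

/-- `h` is a continuous solution on `[a,ξ]` of `h(t) - ∫_a^ξ K(t,s) h(s) ds = I`. -/
def IsTruncSol (K : ℝ → ℝ → Matrix (Fin n) (Fin n) ℂ) (a ξ : ℝ)
    (h : ℝ → Matrix (Fin n) (Fin n) ℂ) : Prop :=
  ContinuousOn h (Icc a ξ) ∧
    ∀ t ∈ Icc a ξ, h t - ∫ s in a..ξ, K t s * h s = 1

/-- `h` is a continuous solution on `[a,ξ]` of `h(t) - ∫_a^ξ h(s) K(s,t) ds = I`. -/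
def IsTruncSolStar (K : ℝ → ℝ → Matrix (Fin n) (Fin n) ℂ) (a ξ : ℝ)
    (h : ℝ → Matrix (Fin n) (Fin n) ℂ) : Prop :=
  ContinuousOn h (Icc a ξ) ∧
    ∀ t ∈ Icc a ξ, h t - ∫ s in a..ξ, h s * K s t = 1

/-- `M(ξ) = ∫_a^ξ g(t,ξ) dt`. -/
def M (a : ℝ) (g : ℝ → ℝ → Matrix (Fin n) (Fin n) ℂ) (ξ : ℝ) : Matrix (Fin n) (Fin n) ℂ :=
  ∫ t in a..ξ, g t ξ

/-- `M'(ξ)` for `ξ ∈ [a,b]`, one-sided at the endpoints. -/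
def M' (a b : ℝ) (g : ℝ → ℝ → Matrix (Fin n) (Fin n) ℂ) (ξ : ℝ) : Matrix (Fin n) (Fin n) ℂ :=
  derivWithin (M a g) (Icc a b) ξ

/-- `G(ξ) = ∫_a^ξ g*(s,ξ) f(s) ds`. -/
def G (a : ℝ) (gs : ℝ → ℝ → Matrix (Fin n) (Fin n) ℂ) (f : ℝ → Fin n → ℂ) (ξ : ℝ) : Fin n → ℂ :=
  ∫ s in a..ξ, gs s ξ *ᵥ f s

/-- `G'(ξ)` for `ξ ∈ [a,b]`, one-sided at the endpoints. -/
def G' (a b : ℝ) (gs : ℝ → ℝ → Matrix (Fin n) (Fin n) ℂ) (f : ℝ → Fin n → ℂ) (ξ : ℝ) :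
    Fin n → ℂ :=
  derivWithin (G a gs f) (Icc a b) ξ

/-- `F(ξ) = [M'(ξ)]⁻¹ (d/dξ) ∫_a^ξ g*(s,ξ) f(s) ds`. -/
def F (a b : ℝ) (g gs : ℝ → ℝ → Matrix (Fin n) (Fin n) ℂ) (f : ℝ → Fin n → ℂ) (ξ : ℝ) :
    Fin n → ℂ :=
  (M' a b g ξ)⁻¹ *ᵥ G' a b gs f ξ

/-- `v` is the Riemann–Stieltjes integral `∫_c^d A(ξ) dF(ξ)`: the limit of the sums
`∑ A(τᵢ) (F(xᵢ₊₁) - F(xᵢ))` over tagged partitions `c = x₀ ≤ τ₀ ≤ x₁ ≤ … ≤ x_N = d` as the mesh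
tends to zero. -/
def IsStieltjesIntegral (A : ℝ → Matrix (Fin n) (Fin n) ℂ) (F : ℝ → Fin n → ℂ) (c d : ℝ)
    (v : Fin n → ℂ) : Prop :=
  ∀ ε > 0, ∃ δ > 0, ∀ (N : ℕ) (x τ : ℕ → ℝ), x 0 = c → x N = d →
    (∀ i < N, x i ≤ τ i ∧ τ i ≤ x (i + 1) ∧ x (i + 1) - x i < δ) →
    ‖(∑ i ∈ Finset.range N, A (τ i) *ᵥ (F (x (i + 1)) - F (x i))) - v‖ < ε

end KreinSystem

end

/-! All truncated equations are moved to the fixed space `C(Icc a b, V)`, where T_ξ u = ∫_a^ξ k(·,s)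
u(s) ds. This family is Lipschitz in ξ for the operator norm, strongly differentiable, and compact.
By the Fredholm alternative, uniqueness makes 1 - T_ξ invertible (`isUnit_one_sub_truncOp`). Put R_ξ
= (1 - T_ξ)⁻¹ and φ_ξ = R_ξ f.

Differentiating the resolvent gives ∂_ξ φ_ξ(t) = Γ_ξ(t) φ_ξ(ξ), where the matrix function Γ_ξ = R_ξ
K(·,ξ) does not depend on f. With f = I this reads ∂_ξ g(t,ξ) = Γ_ξ(t) g(ξ,ξ). Duality of the left
and right equations (`integral_act_eq`) gives ∫_a^ξ g* f = ∫_a^ξ φ_ξ and 1 + ∫_a^ξ Γ_ξ = g*(ξ,ξ).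
Hence the left-hand integral has derivative g*(ξ,ξ) φ_ξ(ξ). In particular M'(ξ) = g*(ξ,ξ) g(ξ,ξ), so
F(ξ) = g(ξ,ξ)⁻¹ φ_ξ(ξ).

Therefore ∂_ξ φ_ξ(t) = ∂_ξ g(t,ξ) F(ξ). Integrating over [t,b] from φ_t(t) = g(t,t) F(t) and then
integrating by parts yields the formula (`truncRes_eq_sub`). Partial integration is valid in the
Stieltjes sense because g(t,·) is C¹ and F is continuous (`exists_stieltjes_sum_lt`), and in the
Lebesgue sense if F is absolutely continuous. -/

noncomputable section

namespace KreinSystem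

open Filter Topology

/-! ### A product rule for strongly differentiable operator families. -/

section Calculus

variable {E F : Type*} [NormedAddCommGroup E] [NormedSpace ℝ E] [NormedAddCommGroup F]
  [NormedSpace ℝ F]

/-- Product rule for `η ↦ A η (φ η)` when `A` is norm continuous but only strongly
differentiable. -/
theorem hasDerivWithinAt_clm_apply_of_strong {A : ℝ → E →L[ℝ] F} {φ : ℝ → E} {φ' : E} {d : F}
    {S : Set ℝ} {ξ : ℝ} (hA : ContinuousWithinAt A S ξ) (hφ : HasDerivWithinAt φ φ' S ξ)
    (hd : HasDerivWithinAt (fun η => A η (φ ξ)) d S ξ) :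
    HasDerivWithinAt (fun η => A η (φ η)) (A ξ φ' + d) S ξ := by
  rw [hasDerivWithinAt_iff_tendsto_slope] at hφ hd ⊢
  -- The slope of the product is A(η) applied to the slope of φ, plus the slope of A(·)φ(ξ); joint
  -- continuity of evaluation handles the first term.
  have h := (((isBoundedBilinearMap_apply (𝕜 := ℝ) (E := E) (F := F)).continuous.tendsto
    (A ξ, φ')).comp ((hA.mono (sdiff_subset (t := {ξ}))).tendsto.prodMk_nhds hφ)).add hd
  refine h.congr fun η => ?_
  simp only [Function.comp_apply, slope, vsub_eq_sub, map_smul, map_sub, ← smul_add]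
  congr 1
  abel

end Calculus

/-! ### Truncated integral operators and their resolvents. -/

section KernelOperator

variable {a b : ℝ} {V : Type*} [NormedAddCommGroup V] [NormedSpace ℝ V]

/-- The continuous function `t ↦ k(t,s) u(s)`, with `s` first projected to `[a,b]`. -/
def kernelSlice (hab : a ≤ b) (k : C(Icc a b × Icc a b, V →L[ℝ] V)) (u : C(Icc a b, V)) (s : ℝ) :
    C(Icc a b, V) where
  toFun t := k (t, projIcc a b hab s) (u (projIcc a b hab s))
  continuous_toFun := by fun_prop

variable (hab : a ≤ b) (k : C(Icc a b × Icc a b, V →L[ℝ] V))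

theorem kernelSlice_apply (u : C(Icc a b, V)) (s : ℝ) (t : Icc a b) :
    kernelSlice hab k u s t = k (t, projIcc a b hab s) (u (projIcc a b hab s)) := rfl

theorem continuous_kernelSlice (u : C(Icc a b, V)) : Continuous (kernelSlice hab k u) := by
  refine ContinuousMap.continuous_of_continuous_uncurry _ ?_
  have h : Continuous fun p : ℝ × Icc a b =>
      k (p.2, projIcc a b hab p.1) (u (projIcc a b hab p.1)) := by
    have := continuous_projIcc (h := hab)
    fun_prop
  exact h

theorem norm_kernelSlice_le (u : C(Icc a b, V)) (s : ℝ) :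
    ‖kernelSlice hab k u s‖ ≤ ‖k‖ * ‖u‖ := by
  rw [ContinuousMap.norm_le _ (by positivity)]
  intro t
  exact (ContinuousLinearMap.le_opNorm _ _).trans
    (mul_le_mul (k.norm_coe_le_norm _) (u.norm_coe_le_norm _) (norm_nonneg _) (by positivity))

/-- The integral operator `u ↦ ∫_a^ξ k(·,s) u(s) ds` on `C([a,b], V)`. -/
def truncOp (ξ : ℝ) : C(Icc a b, V) →L[ℝ] C(Icc a b, V) :=
  LinearMap.mkContinuous
    { toFun := fun u => ∫ s in a..ξ, kernelSlice hab k u s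
      map_add' := fun u v => by
        rw [← intervalIntegral.integral_add
          ((continuous_kernelSlice hab k u).intervalIntegrable _ _)
          ((continuous_kernelSlice hab k v).intervalIntegrable _ _)]
        refine intervalIntegral.integral_congr fun s _ => ?_
        ext t
        simp [kernelSlice_apply]
      map_smul' := fun c u => by
        rw [RingHom.id_apply, ← intervalIntegral.integral_smul]
        refine intervalIntegral.integral_congr fun s _ => ?_
        ext t
        simp [kernelSlice_apply] }
    (‖k‖ * |ξ - a|) fun u => by
      refine (intervalIntegral.norm_integral_le_of_norm_le_const
        fun s _ => norm_kernelSlice_le hab k u s).trans_eq ?_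
      ring

theorem truncOp_eq_integral (ξ : ℝ) (u : C(Icc a b, V)) :
    truncOp hab k ξ u = ∫ s in a..ξ, kernelSlice hab k u s := rfl

theorem truncOp_apply [CompleteSpace V] (ξ : ℝ) (u : C(Icc a b, V)) (t : Icc a b) :
    truncOp hab k ξ u t =
      ∫ s in a..ξ, k (t, projIcc a b hab s) (u (projIcc a b hab s)) := by
  have h := (ContinuousMap.evalCLM (M := V) ℝ t).intervalIntegral_comp_comm
    ((continuous_kernelSlice hab k u).intervalIntegrable (μ := volume) a ξ)
  exact h.symm

theorem truncOp_left : truncOp hab k a = 0 := by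
  ext u : 1
  simp [truncOp_eq_integral]

/-- The difference is an integral over the interval between η and ξ only. -/
theorem norm_truncOp_sub_le (ξ η : ℝ) :
    ‖truncOp hab k ξ - truncOp hab k η‖ ≤ ‖k‖ * |ξ - η| := by
  refine ContinuousLinearMap.opNorm_le_bound _ (by positivity) fun u => ?_
  rw [_root_.sub_apply, truncOp_eq_integral, truncOp_eq_integral,
    intervalIntegral.integral_interval_sub_left
      ((continuous_kernelSlice hab k u).intervalIntegrable _ _)
      ((continuous_kernelSlice hab k u).intervalIntegrable _ _)]
  refine (intervalIntegral.norm_integral_le_of_norm_le_const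
    fun s _ => norm_kernelSlice_le hab k u s).trans_eq ?_
  ring

theorem continuous_truncOp : Continuous (truncOp hab k) := by
  refine (LipschitzWith.of_dist_le_mul (f := truncOp hab k) (K := ‖k‖.toNNReal)
    fun ξ η => ?_).continuous
  rw [dist_eq_norm (truncOp hab k ξ), Real.dist_eq]
  rw [Real.coe_toNNReal _ (by positivity)]
  exact norm_truncOp_sub_le hab k ξ η

/-- The fundamental theorem of calculus for integrals valued in `C(Icc a b, V)`. Differentiability
is claimed only for each fixed `u`. -/
theorem hasDerivAt_truncOp_apply [CompleteSpace V] (u : C(Icc a b, V)) (ξ : ℝ) :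
    HasDerivAt (fun η => truncOp hab k η u) (kernelSlice hab k u ξ) ξ :=
  intervalIntegral.integral_hasDerivAt_right
    ((continuous_kernelSlice hab k u).intervalIntegrable _ _)
    ((continuous_kernelSlice hab k u).stronglyMeasurableAtFilter _ _)
    (continuous_kernelSlice hab k u).continuousAt

theorem dist_truncOp_apply_le [CompleteSpace V] (ξ : ℝ) (u : C(Icc a b, V)) (t t' : Icc a b) :
    dist (truncOp hab k ξ u t) (truncOp hab k ξ u t') ≤
      ‖k.curry t - k.curry t'‖ * ‖u‖ * |ξ - a| := by
  have hc : ∀ t : Icc a b, Continuous fun s : ℝ =>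
      k (t, projIcc a b hab s) (u (projIcc a b hab s)) := fun t =>
    (continuous_eval_const t).comp (continuous_kernelSlice hab k u)
  rw [dist_eq_norm, truncOp_apply, truncOp_apply, ← intervalIntegral.integral_sub
    ((hc t).intervalIntegrable _ _) ((hc t').intervalIntegrable _ _)]
  refine intervalIntegral.norm_integral_le_of_norm_le_const fun s _ => ?_
  rw [← _root_.sub_apply]
  exact (ContinuousLinearMap.le_opNorm _ _).trans
    (mul_le_mul ((k.curry t - k.curry t').norm_coe_le_norm (projIcc a b hab s))
      (u.norm_coe_le_norm _) (norm_nonneg _) (by positivity))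

/-- Arzelà–Ascoli: the image of the unit ball is bounded, and it is equicontinuous because `k.curry`
is continuous for the sup norm in the second variable. -/
theorem isCompactOperator_truncOp [FiniteDimensional ℝ V] (ξ : ℝ) :
    IsCompactOperator (truncOp hab k ξ) := by
  have : ProperSpace V := FiniteDimensional.proper ℝ V
  have : CompleteSpace V := FiniteDimensional.complete ℝ V
  refine (isCompactOperator_iff_isCompact_closure_image_ball
    (truncOp hab k ξ : C(Icc a b, V) →ₗ[ℝ] C(Icc a b, V)) zero_lt_one).2 ?_
  set e := (ContinuousMap.isometryEquivBoundedOfCompact (Icc a b) V) with he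
  set B : Set C(Icc a b, V) := truncOp hab k ξ '' Metric.ball 0 1 with hB
  have hcomp : IsCompact (closure (e '' B)) := by
    refine BoundedContinuousFunction.arzela_ascoli
      (Metric.closedBall (0 : V) ‖truncOp hab k ξ‖) (isCompact_closedBall _ _) _ ?_ ?_
    · rintro _ x ⟨_, ⟨u, hu, rfl⟩, rfl⟩
      rw [mem_ball_zero_iff] at hu
      rw [mem_closedBall_zero_iff]
      exact ((truncOp hab k ξ u).norm_coe_le_norm x).trans
        ((ContinuousLinearMap.le_opNorm _ _).trans
          (mul_le_of_le_one_right (norm_nonneg _) hu.le))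
    · intro t
      refine Metric.equicontinuousAt_of_continuity_modulus
        (fun t' => ‖k.curry t' - k.curry t‖ * 1 * |ξ - a|) ?_ _ (Eventually.of_forall ?_)
      · have h := (((tendsto_iff_norm_sub_tendsto_zero (E := C(Icc a b, V →L[ℝ] V))).1
          (k.curry.continuous.tendsto t)).mul_const 1).mul_const |ξ - a|
        simpa only [zero_mul] using h
      · rintro t' ⟨_, _, ⟨u, hu, rfl⟩, rfl⟩
        rw [mem_ball_zero_iff] at hu
        rw [dist_comm]
        refine (dist_truncOp_apply_le hab k ξ u t' t).trans ?_
        gcongr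
  change IsCompact (closure B)
  rw [← e.toHomeomorph.isCompact_image, e.toHomeomorph.image_closure B]
  exact hcomp

/-- Fredholm alternative: for a compact operator, 1 is either an eigenvalue or a regular value. -/
theorem isUnit_one_sub_truncOp [FiniteDimensional ℝ V] (ξ : ℝ)
    (h : ∀ u, truncOp hab k ξ u = u → u = 0) : IsUnit (1 - truncOp hab k ξ) := by
  rcases (isCompactOperator_truncOp hab k ξ).hasEigenvalue_or_mem_resolventSet
    (one_ne_zero (α := ℝ)) with h1 | h1
  · obtain ⟨u, hu⟩ := h1.exists_hasEigenvector
    exact absurd (h u (by simpa using hu.apply_eq_smul)) hu.2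
  · simpa [spectrum.mem_resolventSet_iff] using h1

/-- The resolvent `(1 - T_ξ)⁻¹` of the truncated integral operator. -/
def truncRes (ξ : ℝ) : C(Icc a b, V) →L[ℝ] C(Icc a b, V) := Ring.inverse (1 - truncOp hab k ξ)

variable {hab k}

theorem truncRes_sub_truncOp {ξ : ℝ} (h : IsUnit (1 - truncOp hab k ξ)) (u : C(Icc a b, V)) :
    truncRes hab k ξ (u - truncOp hab k ξ u) = u := by
  have := Ring.inverse_mul_cancel _ h
  exact congrArg (fun A : C(Icc a b, V) →L[ℝ] C(Icc a b, V) => A u) this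

theorem truncRes_sub_truncOp_truncRes {ξ : ℝ} (h : IsUnit (1 - truncOp hab k ξ))
    (f : C(Icc a b, V)) :
    truncRes hab k ξ f - truncOp hab k ξ (truncRes hab k ξ f) = f := by
  have := Ring.mul_inverse_cancel _ h
  exact congrArg (fun A : C(Icc a b, V) →L[ℝ] C(Icc a b, V) => A f) this

theorem eq_truncRes {ξ : ℝ} (h : IsUnit (1 - truncOp hab k ξ)) {u f : C(Icc a b, V)}
    (hu : u - truncOp hab k ξ u = f) : u = truncRes hab k ξ f := by
  rw [← hu, truncRes_sub_truncOp h]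

theorem continuousAt_truncRes [CompleteSpace V] {ξ : ℝ} (h : IsUnit (1 - truncOp hab k ξ)) :
    ContinuousAt (truncRes hab k) ξ := by
  obtain ⟨x, hx⟩ := h
  have h1 : ContinuousAt (fun η => 1 - truncOp hab k η) ξ :=
    (continuous_const.sub (continuous_truncOp hab k)).continuousAt
  have h2 : ContinuousAt Ring.inverse (1 - truncOp hab k ξ) :=
    hx ▸ NormedRing.inverse_continuousAt (R := C(Icc a b, V) →L[ℝ] C(Icc a b, V)) x
  exact ContinuousAt.comp (f := fun η => 1 - truncOp hab k η) h2 h1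

/-- With u = R_ξ f fixed, R_η f = u + R_η(T_η u - T_ξ u). Norm continuity of R and strong
differentiability of T then suffice. -/
theorem hasDerivWithinAt_truncRes_apply [CompleteSpace V] {S : Set ℝ}
    (h : ∀ ξ ∈ S, IsUnit (1 - truncOp hab k ξ)) (f : C(Icc a b, V)) {ξ : ℝ} (hξ : ξ ∈ S) :
    HasDerivWithinAt (fun η => truncRes hab k η f)
      (truncRes hab k ξ (kernelSlice hab k (truncRes hab k ξ f) ξ)) S ξ := by
  set u := truncRes hab k ξ f with hu
  have h1 : HasDerivWithinAt (fun η => truncOp hab k η u - truncOp hab k ξ u)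
      (kernelSlice hab k u ξ) S ξ :=
    ((hasDerivAt_truncOp_apply hab k u ξ).sub_const _).hasDerivWithinAt
  -- The inner function vanishes at η = ξ, so the strong derivative of R is only needed at the zero
  -- vector, where it is 0.
  have h2 := hasDerivWithinAt_clm_apply_of_strong
    (continuousAt_truncRes (h ξ hξ)).continuousWithinAt h1 (d := 0)
    (by simpa using hasDerivWithinAt_const ξ S (0 : C(Icc a b, V)))
  rw [add_zero] at h2
  refine (h2.add_const u).congr_of_mem (fun η hη => ?_) hξ
  have e1 := truncRes_sub_truncOp (h η hη) u
  have e2 := truncRes_sub_truncOp_truncRes (h ξ hξ) f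
  rw [← hu] at e2
  have : f = (u - truncOp hab k η u) + (truncOp hab k η u - truncOp hab k ξ u) := by
    rw [← e2]; abel
  rw [this, map_add, e1]
  abel

/-- A continuous solution on `[a,ξ]` of the truncated equation is the restriction of the solution
given by the resolvent on `[a,b]`. -/
theorem eqOn_truncRes [CompleteSpace V] {ξ : ℝ} (hξ : ξ ∈ Icc a b) (hu : IsUnit (1 - truncOp hab k ξ))
    (q : C(Icc a b, V)) {h : ℝ → V} (hc : ContinuousOn h (Icc a ξ))
    (he : ∀ t (ht : t ∈ Icc a ξ),
      h t - ∫ s in a..ξ, k (⟨t, ht.1, ht.2.trans hξ.2⟩, projIcc a b hab s) (h s)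
        = q ⟨t, ht.1, ht.2.trans hξ.2⟩) {t : ℝ} (ht : t ∈ Icc a ξ) :
    h t = truncRes hab k ξ q ⟨t, ht.1, ht.2.trans hξ.2⟩ := by
  -- Any continuous extension would do here, since T_ξ only sees values on [a,ξ].
  let h' : C(Icc a b, V) := ⟨fun t => IccExtend hξ.1 ((Icc a ξ).domRestrict h) t,
    (continuousOn_iff_continuous_domRestrict.1 hc).Icc_extend'.comp continuous_subtype_val⟩
  have hh' : ∀ s (hs : s ∈ Icc a ξ), h' ⟨s, hs.1, hs.2.trans hξ.2⟩ = h s := fun s hs =>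
    IccExtend_of_mem hξ.1 ((Icc a ξ).domRestrict h) hs
  have hproj : ∀ s (hs : s ∈ Icc a ξ), projIcc a b hab s = ⟨s, hs.1, hs.2.trans hξ.2⟩ :=
    fun s hs => projIcc_of_mem hab _
  -- The equation itself prescribes the right extension of `h` beyond ξ: this `u` agrees with `h` on
  -- [a,ξ] and solves the equation on all of [a,b].
  set u : C(Icc a b, V) := q + truncOp hab k ξ h' with hudef
  have huh : ∀ s (hs : s ∈ Icc a ξ), u ⟨s, hs.1, hs.2.trans hξ.2⟩ = h s := fun s hs => by
    rw [hudef, ContinuousMap.add_apply, truncOp_apply, ← he s hs]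
    rw [sub_add, sub_eq_self, sub_eq_zero]
    refine intervalIntegral.integral_congr fun r hr => ?_
    rw [uIcc_of_le hξ.1] at hr
    simp only [hproj r hr, hh' r hr]
  have hT : truncOp hab k ξ u = truncOp hab k ξ h' := by
    ext t
    rw [truncOp_apply, truncOp_apply]
    refine intervalIntegral.integral_congr fun r hr => ?_
    rw [uIcc_of_le hξ.1] at hr
    simp only [hproj r hr, hh' r hr, huh r hr]
  rw [← huh t ht, ← eq_truncRes hu (u := u) (f := q) (by rw [hT, hudef]; abel)]

end KernelOperator

/-! ### Riemann–Stieltjes sums and partial integration. -/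

section Stieltjes

variable {V W : Type*} [NormedAddCommGroup V] [NormedSpace ℝ V]
  [NormedAddCommGroup W] [NormedSpace ℝ W] [CompleteSpace W]

theorem integral_eq_sub_of_hasDerivWithinAt_Icc {c d x y : ℝ} {f f' : ℝ → W}
    (hf : ∀ s ∈ Icc c d, HasDerivWithinAt f (f' s) (Icc c d) s) (hf' : ContinuousOn f' (Icc c d))
    (hx : c ≤ x) (hxy : x ≤ y) (hy : y ≤ d) : ∫ s in x..y, f' s = f y - f x := by
  have hsub : Icc x y ⊆ Icc c d := Icc_subset_Icc hx hy
  refine intervalIntegral.integral_eq_sub_of_hasDerivAt_of_le hxy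
    (fun s hs => ((hf s (hsub hs)).continuousWithinAt).mono hsub) (fun s hs => ?_)
    ((hf'.mono hsub).intervalIntegrable_of_Icc hxy)
  exact (hf s (hsub (Ioo_subset_Icc_self hs))).hasDerivAt
    (Icc_mem_nhds (hx.trans_lt hs.1) (hs.2.trans_le hy))

variable {A A' : ℝ → V →L[ℝ] W} {F : ℝ → V} {c d : ℝ}

/-- Splitting at the tag τ, the error of one term equals ∫_x^τ A'(F - F(x)) + ∫_τ^y A'(F - F(y)),
and both integrands are at most Cε. -/
theorem norm_stieltjes_term_le
    (hA : ∀ s ∈ Icc c d, HasDerivWithinAt A (A' s) (Icc c d) s) (hA' : ContinuousOn A' (Icc c d))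
    (hF : ContinuousOn F (Icc c d)) {C ε : ℝ} (hC : ∀ s ∈ Icc c d, ‖A' s‖ ≤ C)
    {x τ y : ℝ} (hx : c ≤ x) (hxτ : x ≤ τ) (hτy : τ ≤ y) (hy : y ≤ d)
    (hFx : ∀ s ∈ Icc x y, ‖F s - F x‖ ≤ ε) (hFy : ∀ s ∈ Icc x y, ‖F s - F y‖ ≤ ε) :
    ‖A τ (F y - F x) - ((A y (F y) - A x (F x)) - ∫ s in x..y, A' s (F s))‖ ≤
      C * ε * (y - x) := by
  have hC0 : 0 ≤ C := (norm_nonneg _).trans (hC x ⟨hx, by linarith⟩)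
  have hε0 : 0 ≤ ε := (norm_nonneg _).trans (hFx x ⟨le_rfl, by linarith⟩)
  have hsub1 : Icc x τ ⊆ Icc c d := Icc_subset_Icc hx (hτy.trans hy)
  have hsub2 : Icc τ y ⊆ Icc c d := Icc_subset_Icc (hx.trans hxτ) hy
  have hAv : ∀ v : V, ∀ s ∈ Icc c d, HasDerivWithinAt (fun s => A s v) (A' s v) (Icc c d) s :=
    fun v s hs => by simpa using (hA s hs).clm_apply (hasDerivWithinAt_const s (Icc c d) v)
  have hAv' : ∀ v : V, ContinuousOn (fun s => A' s v) (Icc c d) :=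
    fun v => hA'.clm_apply continuousOn_const
  have hAF : ContinuousOn (fun s => A' s (F s)) (Icc c d) := hA'.clm_apply hF
  have e1 : ∫ s in x..τ, (A' s (F s) - A' s (F x)) =
      (∫ s in x..τ, A' s (F s)) - (A τ (F x) - A x (F x)) := by
    rw [intervalIntegral.integral_sub ((hAF.mono hsub1).intervalIntegrable_of_Icc hxτ)
      (((hAv' _).mono hsub1).intervalIntegrable_of_Icc hxτ),
      integral_eq_sub_of_hasDerivWithinAt_Icc (hAv _) (hAv' _) hx hxτ (hτy.trans hy)]
  have e2 : ∫ s in τ..y, (A' s (F s) - A' s (F y)) =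
      (∫ s in τ..y, A' s (F s)) - (A y (F y) - A τ (F y)) := by
    rw [intervalIntegral.integral_sub ((hAF.mono hsub2).intervalIntegrable_of_Icc hτy)
      (((hAv' _).mono hsub2).intervalIntegrable_of_Icc hτy),
      integral_eq_sub_of_hasDerivWithinAt_Icc (hAv _) (hAv' _) (hx.trans hxτ) hτy hy]
  have e3 := intervalIntegral.integral_add_adjacent_intervals
    ((hAF.mono hsub1).intervalIntegrable_of_Icc (μ := volume) hxτ)
    ((hAF.mono hsub2).intervalIntegrable_of_Icc (μ := volume) hτy)
  have e4 : A τ (F y - F x) - ((A y (F y) - A x (F x)) - ∫ s in x..y, A' s (F s)) =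
      (∫ s in x..τ, (A' s (F s) - A' s (F x))) + ∫ s in τ..y, (A' s (F s) - A' s (F y)) := by
    rw [e1, e2, ← e3, map_sub]
    abel
  have b1 : ‖∫ s in x..τ, (A' s (F s) - A' s (F x))‖ ≤ C * ε * (τ - x) := by
    rw [← abs_of_nonneg (sub_nonneg.2 hxτ)]
    refine intervalIntegral.norm_integral_le_of_norm_le_const fun s hs => ?_
    rw [uIoc_of_le hxτ] at hs
    have hs' := Ioc_subset_Icc_self hs
    rw [← map_sub]
    exact (ContinuousLinearMap.le_opNorm _ _).trans (mul_le_mul (hC s (hsub1 hs'))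
      (hFx s ⟨hs'.1, hs'.2.trans hτy⟩) (norm_nonneg _) hC0)
  have b2 : ‖∫ s in τ..y, (A' s (F s) - A' s (F y))‖ ≤ C * ε * (y - τ) := by
    rw [← abs_of_nonneg (sub_nonneg.2 hτy)]
    refine intervalIntegral.norm_integral_le_of_norm_le_const fun s hs => ?_
    rw [uIoc_of_le hτy] at hs
    have hs' := Ioc_subset_Icc_self hs
    rw [← map_sub]
    exact (ContinuousLinearMap.le_opNorm _ _).trans (mul_le_mul (hC s (hsub2 hs'))
      (hFy s ⟨hxτ.trans hs'.1, hs'.2⟩) (norm_nonneg _) hC0)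
  rw [e4]
  refine (norm_add_le _ _).trans ((add_le_add b1 b2).trans_eq ?_)
  ring

/-- Riemann–Stieltjes sums `∑ A(τᵢ) (F(xᵢ₊₁) - F(xᵢ))` of a continuously differentiable `A` against
a continuous `F` converge to the value given by partial integration. -/
theorem exists_stieltjes_sum_lt (hcd : c ≤ d)
    (hA : ∀ s ∈ Icc c d, HasDerivWithinAt A (A' s) (Icc c d) s) (hA' : ContinuousOn A' (Icc c d))
    (hF : ContinuousOn F (Icc c d)) {ε : ℝ} (hε : 0 < ε) :
    ∃ δ > 0, ∀ (N : ℕ) (x τ : ℕ → ℝ), x 0 = c → x N = d →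
      (∀ i < N, x i ≤ τ i ∧ τ i ≤ x (i + 1) ∧ x (i + 1) - x i < δ) →
      ‖(∑ i ∈ Finset.range N, A (τ i) (F (x (i + 1)) - F (x i))) -
        ((A d (F d) - A c (F c)) - ∫ s in c..d, A' s (F s))‖ < ε := by
  obtain ⟨C, hC⟩ := isCompact_Icc.exists_bound_of_continuousOn hA'
  have hC0 : 0 ≤ C := (norm_nonneg _).trans (hC c ⟨le_rfl, hcd⟩)
  -- The summand 1 keeps the denominator positive when C(d - c) = 0 and makes the final bound
  -- strict.
  have hD : 0 < C * (d - c) + 1 := by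
    have := mul_nonneg hC0 (sub_nonneg.2 hcd)
    linarith
  have hε' : 0 < ε / (C * (d - c) + 1) := div_pos hε hD
  obtain ⟨δ, hδ, hFδ⟩ := Metric.uniformContinuousOn_iff.1
    (isCompact_Icc.uniformContinuousOn_of_continuous hF) _ hε'
  refine ⟨δ, hδ, fun N x τ hx0 hxN hx => ?_⟩
  have hmono : ∀ i j, i ≤ j → j ≤ N → x i ≤ x j := by
    intro i j hij
    induction j, hij using Nat.le_induction with
    | base => exact fun _ => le_rfl
    | succ j _ ih =>
      intro hj
      have := hx j (by omega)
      exact (ih (by omega)).trans (this.1.trans this.2.1)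
  have hmem : ∀ i ≤ N, x i ∈ Icc c d := fun i hi =>
    ⟨hx0 ▸ hmono 0 i (Nat.zero_le _) hi, hxN ▸ hmono i N hi le_rfl⟩
  have hAF : ContinuousOn (fun s => A' s (F s)) (Icc c d) := hA'.clm_apply hF
  have hint : ∀ i < N, IntervalIntegrable (fun s => A' s (F s)) volume (x i) (x (i + 1)) :=
    fun i hi => (hAF.mono (Icc_subset_Icc (hmem i hi.le).1 (hmem (i + 1) hi).2)
      ).intervalIntegrable_of_Icc (hmono i (i + 1) (Nat.le_succ i) hi)
  have e1 := intervalIntegral.sum_integral_adjacent_intervals hint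
  have e2 := Finset.sum_range_sub (fun i => A (x i) (F (x i))) N
  simp only [hx0, hxN] at e1 e2
  rw [← e1, ← e2, ← Finset.sum_sub_distrib, ← Finset.sum_sub_distrib]
  refine (norm_sum_le_of_le _ (f := fun i => A (τ i) (F (x (i + 1)) - F (x i)) -
      ((A (x (i + 1)) (F (x (i + 1))) - A (x i) (F (x i))) -
        ∫ s in x i..x (i + 1), A' s (F s)))
    (n := fun i => C * (ε / (C * (d - c) + 1)) * (x (i + 1) - x i)) fun i hi => ?_).trans_lt ?_
  · have hi := Finset.mem_range.1 hi
    obtain ⟨h1, h2, h3⟩ := hx i hi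
    have hm1 := hmem i hi.le
    have hm2 := hmem (i + 1) hi
    refine norm_stieltjes_term_le hA hA' hF hC hm1.1 h1 h2 hm2.2 (fun s hs => ?_) fun s hs => ?_
    · rw [← dist_eq_norm]
      refine (hFδ s ⟨hm1.1.trans hs.1, hs.2.trans hm2.2⟩ _ hm1 ?_).le
      rw [Real.dist_eq, abs_of_nonneg (sub_nonneg.2 hs.1)]
      linarith [hs.2]
    · rw [← dist_eq_norm, dist_comm]
      refine (hFδ _ hm2 s ⟨hm1.1.trans hs.1, hs.2.trans hm2.2⟩ ?_).le
      rw [Real.dist_eq, abs_of_nonneg (sub_nonneg.2 hs.2)]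
      linarith [hs.1]
  · rw [← Finset.mul_sum, Finset.sum_range_sub, hx0, hxN]
    have : C * (ε / (C * (d - c) + 1)) * (d - c) =
        ε * (C * (d - c)) / (C * (d - c) + 1) := by ring
    rw [this, div_lt_iff₀ hD]
    linarith

end Stieltjes

/-! ### Absolutely continuous functions with values in finite-dimensional spaces. -/

section AbsolutelyContinuous

variable {V W : Type*} [NormedAddCommGroup V] [NormedSpace ℝ V]
  [NormedAddCommGroup W] [NormedSpace ℝ W] {F : ℝ → V} {c d : ℝ}

/-- A termwise comparison of increments that covers both linear images and bilinear products. -/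
theorem absolutelyContinuousOnInterval_of_dist_le {X Y Z : Type*} [PseudoMetricSpace X]
    [PseudoMetricSpace Y] [PseudoMetricSpace Z] {f : ℝ → X} {g : ℝ → Y} {h : ℝ → Z} {B C : ℝ}
    (hf : AbsolutelyContinuousOnInterval f c d) (hg : AbsolutelyContinuousOnInterval g c d)
    (hle : ∀ x ∈ uIcc c d, ∀ y ∈ uIcc c d,
      dist (h x) (h y) ≤ B * dist (f x) (f y) + C * dist (g x) (g y)) :
    AbsolutelyContinuousOnInterval h c d := by
  unfold AbsolutelyContinuousOnInterval at hf hg ⊢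
  have h0 := (Tendsto.const_mul B hf).add (Tendsto.const_mul C hg)
  rw [mul_zero, mul_zero, add_zero] at h0
  refine squeeze_zero' (Eventually.of_forall fun E =>
    Finset.sum_nonneg fun i _ => dist_nonneg) ?_ h0
  filter_upwards [mem_inf_of_right (mem_principal_self _)] with E hE
  rw [Finset.mul_sum, Finset.mul_sum, ← Finset.sum_add_distrib]
  exact Finset.sum_le_sum fun i hi => hle _ (hE.1 i hi).1 _ (hE.1 i hi).2

theorem _root_.AbsolutelyContinuousOnInterval.clm_comp (hF : AbsolutelyContinuousOnInterval F c d)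
    (ℓ : V →L[ℝ] W) : AbsolutelyContinuousOnInterval (fun x => ℓ (F x)) c d := by
  refine absolutelyContinuousOnInterval_of_dist_le (B := ‖ℓ‖) (C := 0) hF hF
    fun x _ y _ => ?_
  rw [zero_mul, add_zero]
  exact ℓ.lipschitz.dist_le_mul _ _

theorem _root_.AbsolutelyContinuousOnInterval.clm_apply {A : ℝ → V →L[ℝ] W}
    (hA : AbsolutelyContinuousOnInterval A c d) (hF : AbsolutelyContinuousOnInterval F c d) :
    AbsolutelyContinuousOnInterval (fun x => A x (F x)) c d := by
  obtain ⟨B, hB⟩ := hF.exists_bound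
  obtain ⟨C, hC⟩ := hA.exists_bound
  refine absolutelyContinuousOnInterval_of_dist_le (B := B) (C := C) hA hF
    fun x hx y hy => ?_
  rw [dist_eq_norm, dist_eq_norm, dist_eq_norm]
  have : A x (F x) - A y (F y) = (A x - A y) (F x) + A y (F x - F y) := by
    rw [_root_.sub_apply, map_sub]; abel
  rw [this]
  refine (norm_add_le _ _).trans (add_le_add ?_ ?_)
  · rw [mul_comm]
    exact (ContinuousLinearMap.le_opNorm _ _).trans
      (mul_le_mul_of_nonneg_left (hB x hx) (norm_nonneg _))
  · exact (ContinuousLinearMap.le_opNorm _ _).trans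
      (mul_le_mul_of_nonneg_right (hC y hy) (norm_nonneg _))

variable [FiniteDimensional ℝ V]

theorem _root_.AbsolutelyContinuousOnInterval.ae_differentiableAt_of_finiteDimensional
    (hF : AbsolutelyContinuousOnInterval F c d) :
    ∀ᵐ x : ℝ, x ∈ uIcc c d → DifferentiableAt ℝ F x := by
  let e := (Module.finBasis ℝ V).equivFunL
  have h1 : ∀ i, ∀ᵐ x : ℝ, x ∈ uIcc c d → DifferentiableAt ℝ (fun x => e (F x) i) x := fun i =>
    (hF.clm_comp ((ContinuousLinearMap.proj (R := ℝ) (φ := fun _ => ℝ) i).comp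
      (e : V →L[ℝ] Fin (Module.finrank ℝ V) → ℝ))).ae_differentiableAt
  filter_upwards [ae_all_iff.2 h1] with x hx hxm
  have h2 : DifferentiableAt ℝ (fun x => e (F x)) x := differentiableAt_pi.2 fun i => hx i hxm
  have h3 := (e.symm : (Fin (Module.finrank ℝ V) → ℝ) →L[ℝ] V).differentiableAt.comp x h2
  simpa [Function.comp_def] using h3

theorem _root_.AbsolutelyContinuousOnInterval.ae_deriv_clm_comp
    (hF : AbsolutelyContinuousOnInterval F c d) (ℓ : V →L[ℝ] W) :
    ∀ᵐ x : ℝ, x ∈ uIoc c d → ℓ (deriv F x) = deriv (fun x => ℓ (F x)) x := by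
  filter_upwards [hF.ae_differentiableAt_of_finiteDimensional] with x hx hxm
  exact ((ℓ.hasFDerivAt.comp_hasDerivAt x (hx (uIoc_subset_uIcc hxm)).hasDerivAt).deriv).symm

theorem _root_.AbsolutelyContinuousOnInterval.intervalIntegrable_deriv_of_finiteDimensional
    (hF : AbsolutelyContinuousOnInterval F c d) :
    IntervalIntegrable (deriv F) volume c d := by
  let e := (Module.finBasis ℝ V).equivFunL
  have h1 : ∀ i, IntervalIntegrable (fun x => e (deriv F x) i) volume c d := fun i => by
    let ℓ : V →L[ℝ] ℝ := (ContinuousLinearMap.proj i).comp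
      (e : V →L[ℝ] Fin (Module.finrank ℝ V) → ℝ)
    refine (hF.clm_comp ℓ).intervalIntegrable_deriv.congr_ae ?_
    rw [EventuallyEq, ae_restrict_iff' measurableSet_uIoc]
    filter_upwards [AbsolutelyContinuousOnInterval.ae_deriv_clm_comp hF ℓ] with x hx hxm
    exact (hx hxm).symm
  have h2 : IntervalIntegrable (fun x => e (deriv F x)) volume c d := by
    simp only [intervalIntegrable_iff, IntegrableOn] at h1 ⊢
    exact Integrable.of_eval h1
  rw [intervalIntegrable_iff] at h2 ⊢
  have h3 := (e.symm : (Fin (Module.finrank ℝ V) → ℝ) →L[ℝ] V).integrable_comp h2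
  simpa [IntegrableOn] using h3

/-- Testing with real functionals reduces this to the scalar fundamental theorem. -/
theorem _root_.AbsolutelyContinuousOnInterval.integral_deriv_eq_sub_of_finiteDimensional
    (hF : AbsolutelyContinuousOnInterval F c d) : ∫ x in c..d, deriv F x = F d - F c := by
  have : CompleteSpace V := FiniteDimensional.complete ℝ V
  refine (SeparatingDual.eq_iff_forall_dual_eq (R := ℝ)).2 fun ℓ => ?_
  rw [← ℓ.intervalIntegral_comp_comm hF.intervalIntegrable_deriv_of_finiteDimensional, map_sub,
    ← (hF.clm_comp ℓ).integral_deriv_eq_sub]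
  exact intervalIntegral.integral_congr_ae (hF.ae_deriv_clm_comp ℓ)

theorem absolutelyContinuousOnInterval_of_hasDerivWithinAt {A A' : ℝ → W} (hcd : c ≤ d)
    (hA : ∀ s ∈ Icc c d, HasDerivWithinAt A (A' s) (Icc c d) s)
    (hA' : ContinuousOn A' (Icc c d)) : AbsolutelyContinuousOnInterval A c d := by
  obtain ⟨C, hC⟩ := isCompact_Icc.exists_bound_of_continuousOn hA'
  refine LipschitzOnWith.absolutelyContinuousOnInterval (K := C.toNNReal) ?_
  rw [uIcc_of_le hcd]
  refine (convex_Icc c d).lipschitzOnWith_of_nnnorm_hasDerivWithin_le hA fun x hx => ?_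
  rw [← NNReal.coe_le_coe, coe_nnnorm]
  exact (hC x hx).trans (Real.le_coe_toNNReal C)

variable [FiniteDimensional ℝ W]

theorem _root_.AbsolutelyContinuousOnInterval.intervalIntegrable_clm_apply_deriv {A : ℝ → V →L[ℝ] W}
    (hcd : c ≤ d) (hA : ContinuousOn A (Icc c d)) (hF : AbsolutelyContinuousOnInterval F c d) :
    IntervalIntegrable (fun s => A s (deriv F s)) volume c d := by
  have h1 := hF.intervalIntegrable_deriv_of_finiteDimensional
  obtain ⟨C, hC⟩ := isCompact_Icc.exists_bound_of_continuousOn hA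
  rw [intervalIntegrable_iff, uIoc_of_le hcd] at h1 ⊢
  refine (h1.norm.const_mul C).mono' ?_ ?_
  · exact (isBoundedBilinearMap_apply (𝕜 := ℝ) (E := V) (F := W)).continuous.comp_aestronglyMeasurable₂
      ((hA.mono Ioc_subset_Icc_self).aestronglyMeasurable measurableSet_Ioc) h1.1
  · refine (ae_restrict_iff' measurableSet_Ioc).2 (Eventually.of_forall fun s hs => ?_)
    exact (ContinuousLinearMap.le_opNorm _ _).trans
      (mul_le_mul_of_nonneg_right (hC s (Ioc_subset_Icc_self hs)) (norm_nonneg _))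

/-- Partial integration of a continuously differentiable operator function against an absolutely
continuous function. -/
theorem _root_.AbsolutelyContinuousOnInterval.integral_clm_apply_deriv {A A' : ℝ → V →L[ℝ] W}
    (hcd : c ≤ d) (hA : ∀ s ∈ Icc c d, HasDerivWithinAt A (A' s) (Icc c d) s)
    (hA' : ContinuousOn A' (Icc c d)) (hF : AbsolutelyContinuousOnInterval F c d) :
    ∫ s in c..d, A s (deriv F s) = (A d (F d) - A c (F c)) - ∫ s in c..d, A' s (F s) := by
  have hAc : ContinuousOn A (Icc c d) := fun s hs => (hA s hs).continuousWithinAt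
  have hFc : ContinuousOn F (Icc c d) := uIcc_of_le hcd ▸ hF.continuousOn
  have hH := AbsolutelyContinuousOnInterval.clm_apply
    (absolutelyContinuousOnInterval_of_hasDerivWithinAt hcd hA hA') hF
  have h1 := AbsolutelyContinuousOnInterval.intervalIntegrable_clm_apply_deriv hcd hAc hF
  have h2 : IntervalIntegrable (fun s => A' s (F s)) volume c d :=
    (hA'.clm_apply hFc).intervalIntegrable_of_Icc hcd
  rw [← AbsolutelyContinuousOnInterval.integral_deriv_eq_sub_of_finiteDimensional hH,
    eq_sub_iff_add_eq, ← intervalIntegral.integral_add h1 h2]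
  refine intervalIntegral.integral_congr_ae ?_
  -- Discarding the endpoint d turns the one-sided derivative of `A` into a two-sided one, so the
  -- product rule applies almost everywhere.
  filter_upwards [AbsolutelyContinuousOnInterval.ae_differentiableAt_of_finiteDimensional hF,
    Measure.ae_ne volume d] with s hs hsd hsm
  have hsF := (hs (uIoc_subset_uIcc hsm)).hasDerivAt
  rw [uIoc_of_le hcd] at hsm
  have hsA := (hA s (Ioc_subset_Icc_self hsm)).hasDerivAt
    (Icc_mem_nhds hsm.1 (lt_of_le_of_ne hsm.2 hsd))
  rw [(hsA.clm_apply hsF).deriv]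
  abel

end AbsolutelyContinuous

/-! ### Interchanging integrals, and differentiating an integral with moving endpoint. -/

theorem intervalIntegral_swap_of_continuous {W : Type*} [NormedAddCommGroup W] [NormedSpace ℝ W]
    {a c : ℝ} (hac : a ≤ c) {f : ℝ → ℝ → W} (hf : Continuous (Function.uncurry f)) :
    ∫ x in a..c, ∫ y in a..c, f x y = ∫ y in a..c, ∫ x in a..c, f x y := by
  have hint : Integrable (Function.uncurry f)
      ((volume.restrict (uIoc a c)).prod (volume.restrict (Ioc a c))) := by
    rw [Measure.prod_restrict, uIoc_of_le hac]
    exact (hf.continuousOn.integrableOn_compact (isCompact_Icc.prod isCompact_Icc)).mono_set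
      (prod_mono Ioc_subset_Icc_self Ioc_subset_Icc_self)
  have h := intervalIntegral_integral_swap hint
  simpa only [intervalIntegral.integral_of_le hac] using h

theorem hasDerivWithinAt_integral_projIcc {a b : ℝ} (hab : a ≤ b) {V : Type*}
    [NormedAddCommGroup V] [NormedSpace ℝ V] [CompleteSpace V] {φ : ℝ → C(Icc a b, V)}
    {φ' : C(Icc a b, V)} {S : Set ℝ} {ξ : ℝ} (hφ : HasDerivWithinAt φ φ' S ξ) :
    HasDerivWithinAt (fun η => ∫ t in a..η, φ η (projIcc a b hab t))
      ((∫ t in a..ξ, φ' (projIcc a b hab t)) + φ ξ (projIcc a b hab ξ)) S ξ := by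
  -- For the constant identity kernel, T_η u is the constant function ∫_a^η u, so the product rule
  -- for T applies; evaluation at a is an arbitrary choice.
  let k : C(Icc a b × Icc a b, V →L[ℝ] V) := ContinuousMap.const _ (ContinuousLinearMap.id ℝ V)
  have h := hasDerivWithinAt_clm_apply_of_strong
    (continuous_truncOp hab k).continuousWithinAt hφ
    (hasDerivAt_truncOp_apply hab k (φ ξ) ξ).hasDerivWithinAt
  have h' := (ContinuousMap.evalCLM (M := V) ℝ
    (⟨a, le_rfl, hab⟩ : Icc a b)).hasFDerivAt.comp_hasDerivWithinAt ξ h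
  have hk : ∀ η (u : C(Icc a b, V)), ContinuousMap.evalCLM (M := V) ℝ
      (⟨a, le_rfl, hab⟩ : Icc a b) (truncOp hab k η u) = ∫ t in a..η, u (projIcc a b hab t) :=
    fun η u => truncOp_apply hab k η u _
  simp only [map_add, hk, Function.comp_def] at h'
  exact h'

/-! ### Left and right equations, their duality, and the diagonal derivatives. -/

section Action

variable {a b : ℝ} {𝔸 W : Type*} [NormedRing 𝔸] [NormedAlgebra ℝ 𝔸]
  [NormedAddCommGroup W] [NormedSpace ℝ W]

/-- The operator kernel on `W` obtained by letting an algebra-valued kernel act on `W`. -/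
def actKernel (ρ : 𝔸 →L[ℝ] W →L[ℝ] W) (K : C(Icc a b × Icc a b, 𝔸)) :
    C(Icc a b × Icc a b, W →L[ℝ] W) where
  toFun p := ρ (K p)
  continuous_toFun := by fun_prop

/-- The kernel `(t,s) ↦ (x ↦ x K(s,t))`. -/
def rightKernel (K : C(Icc a b × Icc a b, 𝔸)) : C(Icc a b × Icc a b, 𝔸 →L[ℝ] 𝔸) where
  toFun p := (ContinuousLinearMap.mul ℝ 𝔸).flip (K p.swap)
  continuous_toFun := by fun_prop

/-- The kernel `(t,s) ↦ (x ↦ K(t,s) x)`. -/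
abbrev leftKernel (K : C(Icc a b × Icc a b, 𝔸)) : C(Icc a b × Icc a b, 𝔸 →L[ℝ] 𝔸) :=
  actKernel (ContinuousLinearMap.mul ℝ 𝔸) K

/-- The function `t ↦ x(t) w`. -/
def actOn (ρ : 𝔸 →L[ℝ] W →L[ℝ] W) (x : C(Icc a b, 𝔸)) (w : W) : C(Icc a b, W) where
  toFun t := ρ (x t) w
  continuous_toFun := by fun_prop

theorem actKernel_apply (ρ : 𝔸 →L[ℝ] W →L[ℝ] W) (K : C(Icc a b × Icc a b, 𝔸))
    (p : Icc a b × Icc a b) (w : W) : actKernel ρ K p w = ρ (K p) w := rfl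

theorem rightKernel_apply (K : C(Icc a b × Icc a b, 𝔸)) (p : Icc a b × Icc a b) (x : 𝔸) :
    rightKernel K p x = x * K p.swap := rfl

theorem actOn_apply (ρ : 𝔸 →L[ℝ] W →L[ℝ] W) (x : C(Icc a b, 𝔸)) (w : W) (t : Icc a b) :
    actOn ρ x w t = ρ (x t) w := rfl

variable [FiniteDimensional ℝ 𝔸] [FiniteDimensional ℝ W] (hab : a ≤ b)
  {ρ : 𝔸 →L[ℝ] W →L[ℝ] W} (hρ : ∀ x y w, ρ (x * y) w = ρ x (ρ y w)) (hρ1 : ∀ w, ρ 1 w = w)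
  (K : C(Icc a b × Icc a b, 𝔸))

include hρ

/-- By Fubini, the right operator is the transpose of the left one for the pairing ∫_a^ξ ρ(p) u. -/
theorem integral_act_truncOp {ξ : ℝ} (hξ : a ≤ ξ) (p : C(Icc a b, 𝔸)) (u : C(Icc a b, W)) :
    ∫ t in a..ξ, ρ (p (projIcc a b hab t)) (truncOp hab (actKernel ρ K) ξ u (projIcc a b hab t)) =
      ∫ s in a..ξ, ρ (truncOp hab (rightKernel K) ξ p (projIcc a b hab s))
        (u (projIcc a b hab s)) := by
  have := FiniteDimensional.complete ℝ 𝔸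
  have := FiniteDimensional.complete ℝ W
  have hpr : Continuous (projIcc a b hab) := continuous_projIcc
  have hswap := intervalIntegral_swap_of_continuous hξ
    (f := fun t s => ρ (p (projIcc a b hab t) * K (projIcc a b hab t, projIcc a b hab s))
      (u (projIcc a b hab s))) (by unfold Function.uncurry; fun_prop)
  refine Eq.trans (intervalIntegral.integral_congr fun t _ => ?_)
    (hswap.trans (intervalIntegral.integral_congr fun s _ => ?_))
  · simp only [truncOp_apply, actKernel_apply, hρ]
    refine ((ρ (p (projIcc a b hab t))).intervalIntegral_comp_comm
      (Continuous.intervalIntegrable ?_ _ _)).symm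
    fun_prop
  · simp only [truncOp_apply, rightKernel_apply, Prod.swap_prod_mk]
    refine (ρ.flip (u (projIcc a b hab s))).intervalIntegral_comp_comm
      (Continuous.intervalIntegrable ?_ _ _)
    fun_prop

variable {hab K}

/-- Duality between the left and the right truncated equations. -/
theorem integral_act_eq {ξ : ℝ} (hξ : a ≤ ξ) {p q : C(Icc a b, 𝔸)} {u f : C(Icc a b, W)}
    (hp : p - truncOp hab (rightKernel K) ξ p = q) (hu : u - truncOp hab (actKernel ρ K) ξ u = f) :
    ∫ t in a..ξ, ρ (p (projIcc a b hab t)) (f (projIcc a b hab t)) =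
      ∫ t in a..ξ, ρ (q (projIcc a b hab t)) (u (projIcc a b hab t)) := by
  have hpr : Continuous (projIcc a b hab) := continuous_projIcc
  have h := integral_act_truncOp hab hρ K hξ p u
  subst hp hu
  simp only [ContinuousMap.sub_apply, map_sub, _root_.sub_apply]
  rw [intervalIntegral.integral_sub, intervalIntegral.integral_sub, h] <;>
  · refine Continuous.intervalIntegrable ?_ _ _
    fun_prop

theorem truncOp_actOn (ξ : ℝ) (x : C(Icc a b, 𝔸)) (w : W) :
    truncOp hab (actKernel ρ K) ξ (actOn ρ x w) = actOn ρ (truncOp hab (leftKernel K) ξ x) w := by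
  have := FiniteDimensional.complete ℝ 𝔸
  have := FiniteDimensional.complete ℝ W
  have hpr : Continuous (projIcc a b hab) := continuous_projIcc
  ext t
  simp only [truncOp_apply, actOn_apply, actKernel_apply, ← hρ]
  refine (ρ.flip w).intervalIntegral_comp_comm
    (f := fun s => K (t, projIcc a b hab s) * x (projIcc a b hab s))
    (Continuous.intervalIntegrable ?_ _ _)
  fun_prop

omit hρ in
-- If p solves the homogeneous right equation, solvability of the left equation for every right-hand
-- side makes p orthogonal to all f, hence zero on [a,ξ]; then p = T_ξ p vanishes everywhere.
theorem isUnit_one_sub_truncOp_rightKernel {ξ : ℝ} (hξ : ξ ∈ Icc a b)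
    (h : IsUnit (1 - truncOp hab (leftKernel K) ξ)) :
    IsUnit (1 - truncOp hab (rightKernel K) ξ) := by
  have := FiniteDimensional.complete ℝ 𝔸
  have hpr : Continuous (projIcc a b hab) := continuous_projIcc
  refine isUnit_one_sub_truncOp hab _ ξ fun p hp => ?_
  rcases hξ.1.eq_or_lt with rfl | haξ
  · rw [← hp, truncOp_left, _root_.zero_apply]
  have hzero : ∀ s ∈ Icc a ξ, p (projIcc a b hab s) = 0 := by
    intro s hs
    refine (SeparatingDual.eq_iff_forall_dual_eq (R := ℝ)).2 fun ℓ => ?_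
    rw [map_zero]
    -- With this test function, ℓ of the duality identity becomes ∫_a^ξ ℓ(p)² = 0.
    let f : C(Icc a b, 𝔸) := ⟨fun t => ℓ (p t) • 1, by fun_prop⟩
    have h1 := integral_act_eq (ρ := ContinuousLinearMap.mul ℝ 𝔸) (fun x y w => mul_assoc x y w)
      hξ.1 (sub_eq_zero.2 hp.symm) (truncRes_sub_truncOp_truncRes h f)
    have h2 := congrArg ℓ h1
    rw [← ℓ.intervalIntegral_comp_comm (Continuous.intervalIntegrable (by fun_prop) _ _)] at h2
    simp only [f, ContinuousMap.coe_mk, ContinuousLinearMap.mul_apply', mul_one,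
      map_smul, ContinuousMap.zero_apply, _root_.zero_apply, intervalIntegral.integral_zero, map_zero,
      smul_eq_mul] at h2
    by_contra hne
    refine (intervalIntegral.integral_pos haξ (Continuous.continuousOn ?_)
      (fun x _ => mul_self_nonneg (ℓ (p (projIcc a b hab x))))
      ⟨s, hs, mul_self_pos.2 hne⟩).ne' h2
    fun_prop
  ext t
  rw [← hp, truncOp_apply]
  refine (intervalIntegral.integral_congr fun s hs => ?_).trans intervalIntegral.integral_zero
  rw [uIcc_of_le hξ.1] at hs
  simp only [hzero s hs, map_zero]

omit hρ in
/-- Solvability transfers along an injective intertwining map `W → 𝔸`. -/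
theorem isUnit_one_sub_truncOp_actKernel {ι : W →L[ℝ] 𝔸} (hι : ∀ x w, ι (ρ x w) = x * ι w)
    (hinj : Function.Injective ι) {ξ : ℝ} (h : IsUnit (1 - truncOp hab (leftKernel K) ξ)) :
    IsUnit (1 - truncOp hab (actKernel ρ K) ξ) := by
  have := FiniteDimensional.complete ℝ 𝔸
  have := FiniteDimensional.complete ℝ W
  have hpr : Continuous (projIcc a b hab) := continuous_projIcc
  refine isUnit_one_sub_truncOp hab _ ξ fun u hu => ?_
  let v : C(Icc a b, 𝔸) := ⟨fun t => ι (u t), by fun_prop⟩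
  have hv : truncOp hab (leftKernel K) ξ v = v := by
    ext t
    change _ = ι (u t)
    rw [← hu, truncOp_apply, truncOp_apply, ← ι.intervalIntegral_comp_comm
      (Continuous.intervalIntegrable (by fun_prop) _ _)]
    simp only [actKernel_apply, hι]
    rfl
  have hv0 : v = 0 := by
    rw [← truncRes_sub_truncOp h v, hv, sub_self, map_zero]
  ext t
  refine hinj ?_
  rw [ContinuousMap.zero_apply, map_zero]
  exact congrArg (fun x : C(Icc a b, 𝔸) => x t) hv0

omit hρ in
variable (hab K) in
/-- The last column `Γ_ξ(·,ξ)` of the resolvent kernel of the truncated equation. -/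
def resolventColumn (ξ : ℝ) : C(Icc a b, 𝔸) :=
  truncRes hab (leftKernel K) ξ (kernelSlice hab (leftKernel K) 1 ξ)

/-- The slice is K(·,ξ) acting on the constant u(ξ), and the resolvent commutes with acting on a
constant. This makes one Γ_ξ serve every right-hand side. -/
theorem truncRes_kernelSlice {ξ : ℝ} (hl : IsUnit (1 - truncOp hab (leftKernel K) ξ))
    (hw : IsUnit (1 - truncOp hab (actKernel ρ K) ξ)) (u : C(Icc a b, W)) :
    truncRes hab (actKernel ρ K) ξ (kernelSlice hab (actKernel ρ K) u ξ) =
      actOn ρ (resolventColumn hab K ξ) (u (projIcc a b hab ξ)) := by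
  symm
  refine eq_truncRes hw ?_
  rw [truncOp_actOn hρ]
  have h := truncRes_sub_truncOp_truncRes hl (kernelSlice hab (leftKernel K) 1 ξ)
  ext t
  have ht := congrArg (fun x : C(Icc a b, 𝔸) => ρ (x t) (u (projIcc a b hab ξ))) h
  simpa [actOn_apply, kernelSlice_apply, actKernel_apply, resolventColumn] using ht

theorem hasDerivWithinAt_truncRes_actKernel
    (hl : ∀ ξ ∈ Icc a b, IsUnit (1 - truncOp hab (leftKernel K) ξ))
    (hw : ∀ ξ ∈ Icc a b, IsUnit (1 - truncOp hab (actKernel ρ K) ξ)) (f : C(Icc a b, W))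
    {ξ : ℝ} (hξ : ξ ∈ Icc a b) :
    HasDerivWithinAt (fun η => truncRes hab (actKernel ρ K) η f)
      (actOn ρ (resolventColumn hab K ξ)
        (truncRes hab (actKernel ρ K) ξ f (projIcc a b hab ξ))) (Icc a b) ξ := by
  have := FiniteDimensional.complete ℝ W
  rw [← truncRes_kernelSlice hρ (hl ξ hξ) (hw ξ hξ)]
  exact hasDerivWithinAt_truncRes_apply hw f hξ

theorem hasDerivWithinAt_truncRes_actKernel_apply
    (hl : ∀ ξ ∈ Icc a b, IsUnit (1 - truncOp hab (leftKernel K) ξ))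
    (hw : ∀ ξ ∈ Icc a b, IsUnit (1 - truncOp hab (actKernel ρ K) ξ)) (f : C(Icc a b, W))
    (t : Icc a b) {ξ : ℝ} (hξ : ξ ∈ Icc a b) :
    HasDerivWithinAt (fun η => truncRes hab (actKernel ρ K) η f t)
      (ρ (resolventColumn hab K ξ t)
        (truncRes hab (actKernel ρ K) ξ f (projIcc a b hab ξ))) (Icc a b) ξ :=
  (ContinuousMap.evalCLM (M := W) ℝ t).hasFDerivAt.comp_hasDerivWithinAt ξ
    (hasDerivWithinAt_truncRes_actKernel hρ hl hw f hξ)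

omit hρ in
theorem hasDerivWithinAt_truncRes_leftKernel_apply
    (hl : ∀ ξ ∈ Icc a b, IsUnit (1 - truncOp hab (leftKernel K) ξ)) (f : C(Icc a b, 𝔸))
    (t : Icc a b) {ξ : ℝ} (hξ : ξ ∈ Icc a b) :
    HasDerivWithinAt (fun η => truncRes hab (leftKernel K) η f t)
      (resolventColumn hab K ξ t *
        truncRes hab (leftKernel K) ξ f (projIcc a b hab ξ)) (Icc a b) ξ :=
  hasDerivWithinAt_truncRes_actKernel_apply (ρ := ContinuousLinearMap.mul ℝ 𝔸)
    (fun x y w => mul_assoc x y w) hl hl f t hξ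

omit hρ in
-- Duality between g* and Γ_ξ, with right-hand sides 1 and K(·,ξ), gives ∫ Γ_ξ = ∫ g*(s,ξ) K(s,ξ)
-- ds; the equation for g* at t = ξ identifies the latter as g*(ξ,ξ) - 1.
theorem truncRes_rightKernel_one_diag {ξ : ℝ} (hξ : ξ ∈ Icc a b)
    (hl : IsUnit (1 - truncOp hab (leftKernel K) ξ)) :
    (∫ t in a..ξ, resolventColumn hab K ξ (projIcc a b hab t)) + 1 =
      truncRes hab (rightKernel K) ξ 1 (projIcc a b hab ξ) := by
  have := FiniteDimensional.complete ℝ 𝔸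
  have hr := truncRes_sub_truncOp_truncRes (isUnit_one_sub_truncOp_rightKernel hξ hl) 1
  have h := integral_act_eq (ρ := ContinuousLinearMap.mul ℝ 𝔸) (fun x y w => mul_assoc x y w)
    hξ.1 hr (truncRes_sub_truncOp_truncRes hl (kernelSlice hab (leftKernel K) 1 ξ))
  have h2 := congrArg (fun x : C(Icc a b, 𝔸) => x (projIcc a b hab ξ)) hr
  simp only [ContinuousMap.sub_apply, truncOp_apply, rightKernel_apply, Prod.swap_prod_mk,
    ContinuousMap.one_apply] at h2
  simp only [ContinuousLinearMap.mul_apply', kernelSlice_apply, actKernel_apply,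
    ContinuousMap.one_apply, mul_one, one_mul] at h
  rw [sub_eq_iff_eq_add, h] at h2
  rw [h2, add_comm]
  rfl

include hρ1

/-- The moving endpoint contributes φ_ξ(ξ) and the integrand contributes (∫ Γ_ξ) φ_ξ(ξ); together
the factor is g*(ξ,ξ). -/
theorem hasDerivWithinAt_integral_truncRes
    (hl : ∀ ξ ∈ Icc a b, IsUnit (1 - truncOp hab (leftKernel K) ξ))
    (hw : ∀ ξ ∈ Icc a b, IsUnit (1 - truncOp hab (actKernel ρ K) ξ)) (f : C(Icc a b, W))
    {ξ : ℝ} (hξ : ξ ∈ Icc a b) :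
    HasDerivWithinAt
      (fun η => ∫ t in a..η, truncRes hab (actKernel ρ K) η f (projIcc a b hab t))
      (ρ (truncRes hab (rightKernel K) ξ 1 (projIcc a b hab ξ))
        (truncRes hab (actKernel ρ K) ξ f (projIcc a b hab ξ))) (Icc a b) ξ := by
  have := FiniteDimensional.complete ℝ 𝔸
  have := FiniteDimensional.complete ℝ W
  have hpr : Continuous (projIcc a b hab) := continuous_projIcc
  have h := hasDerivWithinAt_integral_projIcc hab
    (hasDerivWithinAt_truncRes_actKernel hρ hl hw f hξ)
  convert h using 1
  simp only [actOn_apply]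
  rw [← truncRes_rightKernel_one_diag hξ (hl ξ hξ), map_add, _root_.add_apply, hρ1]
  congr 1
  refine ((ρ.flip _).intervalIntegral_comp_comm
    (Continuous.intervalIntegrable ?_ _ _)).symm
  fun_prop

omit hρ hρ1 in
theorem hasDerivWithinAt_integral_truncRes_leftKernel
    (hl : ∀ ξ ∈ Icc a b, IsUnit (1 - truncOp hab (leftKernel K) ξ)) (f : C(Icc a b, 𝔸))
    {ξ : ℝ} (hξ : ξ ∈ Icc a b) :
    HasDerivWithinAt
      (fun η => ∫ t in a..η, truncRes hab (leftKernel K) η f (projIcc a b hab t))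
      (truncRes hab (rightKernel K) ξ 1 (projIcc a b hab ξ) *
        truncRes hab (leftKernel K) ξ f (projIcc a b hab ξ)) (Icc a b) ξ :=
  hasDerivWithinAt_integral_truncRes (ρ := ContinuousLinearMap.mul ℝ 𝔸)
    (fun x y w => mul_assoc x y w) one_mul hl hl f hξ

theorem integral_act_truncRes_rightKernel {ξ : ℝ} (hξ : ξ ∈ Icc a b)
    (hl : IsUnit (1 - truncOp hab (leftKernel K) ξ))
    (hw : IsUnit (1 - truncOp hab (actKernel ρ K) ξ)) (f : C(Icc a b, W)) :
    ∫ t in a..ξ, ρ (truncRes hab (rightKernel K) ξ 1 (projIcc a b hab t)) (f (projIcc a b hab t)) =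
      ∫ t in a..ξ, truncRes hab (actKernel ρ K) ξ f (projIcc a b hab t) := by
  have h := integral_act_eq hρ hξ.1
    (truncRes_sub_truncOp_truncRes (isUnit_one_sub_truncOp_rightKernel hξ hl) 1)
    (truncRes_sub_truncOp_truncRes hw f)
  simpa only [ContinuousMap.one_apply, hρ1] using h

end Action

/-! ### Continuity of resolvent solutions in ξ, including on the diagonal. -/

section Continuity

variable {a b : ℝ} {V : Type*} [NormedAddCommGroup V] [NormedSpace ℝ V] [CompleteSpace V]
  {hab : a ≤ b} {k : C(Icc a b × Icc a b, V →L[ℝ] V)}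

theorem continuousOn_truncRes_apply
    (h : ∀ ξ ∈ Icc a b, IsUnit (1 - truncOp hab k ξ)) {f : ℝ → C(Icc a b, V)}
    (hf : ContinuousOn f (Icc a b)) :
    ContinuousOn (fun ξ => truncRes hab k ξ (f ξ)) (Icc a b) :=
  ContinuousOn.clm_apply (fun ξ hξ => (continuousAt_truncRes (h ξ hξ)).continuousWithinAt) hf

theorem truncRes_apply_sub_integral {ξ : ℝ} (h : IsUnit (1 - truncOp hab k ξ))
    (f : C(Icc a b, V)) (t : Icc a b) :
    truncRes hab k ξ f t - ∫ s in a..ξ, k (t, projIcc a b hab s)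
      (truncRes hab k ξ f (projIcc a b hab s)) = f t := by
  have h1 := congrArg (fun x : C(Icc a b, V) => x t) (truncRes_sub_truncOp_truncRes h f)
  simpa only [ContinuousMap.sub_apply, truncOp_apply] using h1

theorem continuousOn_truncRes_diag
    (h : ∀ ξ ∈ Icc a b, IsUnit (1 - truncOp hab k ξ)) (f : C(Icc a b, V)) :
    ContinuousOn (fun ξ => truncRes hab k ξ f (projIcc a b hab ξ)) (Icc a b) := by
  have h1 := continuousOn_truncRes_apply h (f := fun _ => f) continuousOn_const
  have h2 : ContinuousOn (projIcc a b hab) (Icc a b) := continuous_projIcc.continuousOn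
  exact ContinuousEval.continuous_eval.comp_continuousOn (h1.prodMk h2)

end Continuity

/-! ### Matrices acting on vectors, and vectors embedded as matrices. -/

section Matrices

variable {n : ℕ}

/-- The action of matrices on vectors as a continuous bilinear map. -/
def mulVecL (n : ℕ) :
    Matrix (Fin n) (Fin n) ℂ →L[ℝ] (Fin n → ℂ) →L[ℝ] (Fin n → ℂ) :=
  LinearMap.toContinuousBilinearMap
    (LinearMap.mk₂ ℝ (fun A v => A *ᵥ v) Matrix.add_mulVec
      (fun c A v => Matrix.smul_mulVec c A v) Matrix.mulVec_add
      fun c A v => Matrix.mulVec_smul A c v)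

theorem mulVecL_apply (A : Matrix (Fin n) (Fin n) ℂ) (v : Fin n → ℂ) :
    mulVecL n A v = A *ᵥ v := rfl

theorem mulVecL_mul (A B : Matrix (Fin n) (Fin n) ℂ) (v : Fin n → ℂ) :
    mulVecL n (A * B) v = mulVecL n A (mulVecL n B v) := (Matrix.mulVec_mulVec v A B).symm

theorem mulVecL_one (v : Fin n → ℂ) : mulVecL n 1 v = v := Matrix.one_mulVec v

/-- The matrix all of whose columns equal a given vector. -/
def columnsL (n : ℕ) : (Fin n → ℂ) →L[ℝ] Matrix (Fin n) (Fin n) ℂ :=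
  LinearMap.toContinuousLinearMap
    { toFun := fun v => Matrix.vecMulVec v 1
      map_add' := fun v w => Matrix.add_vecMulVec v w 1
      map_smul' := fun c v => Matrix.smul_vecMulVec c v 1 }

theorem columnsL_mulVecL (A : Matrix (Fin n) (Fin n) ℂ) (v : Fin n → ℂ) :
    columnsL n (mulVecL n A v) = A * columnsL n v :=
  (Matrix.mul_vecMulVec A v 1).symm

theorem columnsL_injective : Function.Injective (columnsL n) := fun v w h => by
  ext i
  -- The row index also serves as the column index, so n = 0 needs no separate case.
  have := congrFun (congrFun h i) i
  simpa [columnsL, Matrix.vecMulVec_apply] using this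

end Matrices

/-! ### Translation between the stated equations and the operators. -/

section Equations

variable {n : ℕ} {a b : ℝ} {K : ℝ → ℝ → Matrix (Fin n) (Fin n) ℂ}

/-- The restriction of the kernel to the square as a bundled continuous function. -/
def kernelMap (hK : ContinuousOn (fun p : ℝ × ℝ => K p.1 p.2) (Icc a b ×ˢ Icc a b)) :
    C(Icc a b × Icc a b, Matrix (Fin n) (Fin n) ℂ) where
  toFun p := K p.1 p.2
  continuous_toFun := hK.comp_continuous (f := fun p : Icc a b × Icc a b => ((p.1 : ℝ), (p.2 : ℝ)))
    (by fun_prop) fun p => ⟨p.1.2, p.2.2⟩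

variable (hK : ContinuousOn (fun p : ℝ × ℝ => K p.1 p.2) (Icc a b ×ˢ Icc a b))

theorem kernelMap_apply (p : Icc a b × Icc a b) : kernelMap hK p = K p.1 p.2 := rfl

theorem coe_projIcc_of_mem (hab : a ≤ b) {s : ℝ} (hs : s ∈ Icc a b) :
    (projIcc a b hab s : ℝ) = s := by rw [projIcc_of_mem hab hs]

include hK in
theorem continuousOn_kernel_left {t : ℝ} (ht : t ∈ Icc a b) :
    ContinuousOn (fun s => K t s) (Icc a b) :=
  hK.comp (f := fun s => (t, s)) (by fun_prop) fun _ hs => ⟨ht, hs⟩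

/-- Adding a homogeneous solution to g gives another solution, so uniqueness forces it to vanish on
[a,ξ] and hence everywhere. At ξ = a, where uniqueness is not assumed, T_a = 0. -/
theorem isUnit_leftKernel (hab : a < b) {g : ℝ → ℝ → Matrix (Fin n) (Fin n) ℂ}
    (hg : ∀ ξ ∈ Icc a b, IsTruncSol K a ξ (fun t => g t ξ))
    (hg_unique : ∀ ξ ∈ Ioc a b, ∀ h : ℝ → Matrix (Fin n) (Fin n) ℂ,
      IsTruncSol K a ξ h → EqOn h (fun t => g t ξ) (Icc a ξ)) {ξ : ℝ} (hξ : ξ ∈ Icc a b) :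
    IsUnit (1 - truncOp hab.le (leftKernel (kernelMap hK)) ξ) := by
  refine isUnit_one_sub_truncOp hab.le _ ξ fun u hu => ?_
  rcases hξ.1.eq_or_lt with rfl | haξ
  · rw [← hu, truncOp_left, _root_.zero_apply]
  have hsub : Icc a ξ ⊆ Icc a b := Icc_subset_Icc_right hξ.2
  have huc : Continuous fun t : ℝ => u (projIcc a b hab.le t) :=
    u.continuous.comp continuous_projIcc
  have hgξ := hg ξ hξ
  have hzero : ∀ t ∈ Icc a ξ, u (projIcc a b hab.le t) = 0 := by
    intro t ht
    have h := hg_unique ξ ⟨haξ, hξ.2⟩ (fun t => g t ξ + u (projIcc a b hab.le t))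
      ⟨hgξ.1.add huc.continuousOn, fun t ht => ?_⟩ ht
    · simpa using h
    · have hKt := (continuousOn_kernel_left hK (hsub ht)).mono hsub
      have e1 := hgξ.2 t ht
      have e2 : u (projIcc a b hab.le t) = ∫ s in a..ξ, K t s * u (projIcc a b hab.le s) := by
        conv_lhs => rw [← hu]
        rw [truncOp_apply]
        refine intervalIntegral.integral_congr fun s hs => ?_
        rw [uIcc_of_le hξ.1] at hs
        simp only [actKernel_apply, ContinuousLinearMap.mul_apply', kernelMap_apply,
          coe_projIcc_of_mem hab.le (hsub hs), coe_projIcc_of_mem hab.le (hsub ht)]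
      have hi1 : IntervalIntegrable (fun s => K t s * g s ξ) volume a ξ :=
        (hKt.mul hgξ.1).intervalIntegrable_of_Icc hξ.1
      have hi2 : IntervalIntegrable (fun s => K t s * u (projIcc a b hab.le s)) volume a ξ :=
        (hKt.mul huc.continuousOn).intervalIntegrable_of_Icc hξ.1
      simp only [mul_add]
      rw [intervalIntegral.integral_add hi1 hi2, ← e1, ← e2]
      abel
  ext1 t
  rw [← hu, truncOp_apply]
  refine (intervalIntegral.integral_congr fun s hs => ?_).trans intervalIntegral.integral_zero
  rw [uIcc_of_le hξ.1] at hs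
  simp only [hzero s hs, map_zero]

variable {hK} {hab : a ≤ b} {ξ : ℝ}

theorem IsTruncSol.eq_truncRes (hξ : ξ ∈ Icc a b)
    (hu : IsUnit (1 - truncOp hab (leftKernel (kernelMap hK)) ξ))
    {h : ℝ → Matrix (Fin n) (Fin n) ℂ} (hh : IsTruncSol K a ξ h) {t : ℝ} (ht : t ∈ Icc a ξ) :
    h t = truncRes hab (leftKernel (kernelMap hK)) ξ 1 (projIcc a b hab t) := by
  have hsub : Icc a ξ ⊆ Icc a b := Icc_subset_Icc_right hξ.2
  rw [projIcc_of_mem hab (hsub ht)]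
  refine eqOn_truncRes hξ hu 1 hh.1 (fun t ht => ?_) ht
  rw [ContinuousMap.one_apply, ← hh.2 t ht]
  congr 1
  refine intervalIntegral.integral_congr fun s hs => ?_
  rw [uIcc_of_le hξ.1] at hs
  simp only [actKernel_apply, ContinuousLinearMap.mul_apply', kernelMap_apply,
    coe_projIcc_of_mem hab (hsub hs)]

theorem IsTruncSolStar.eq_truncRes (hξ : ξ ∈ Icc a b)
    (hu : IsUnit (1 - truncOp hab (rightKernel (kernelMap hK)) ξ))
    {h : ℝ → Matrix (Fin n) (Fin n) ℂ} (hh : IsTruncSolStar K a ξ h) {t : ℝ}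
    (ht : t ∈ Icc a ξ) :
    h t = truncRes hab (rightKernel (kernelMap hK)) ξ 1 (projIcc a b hab t) := by
  have hsub : Icc a ξ ⊆ Icc a b := Icc_subset_Icc_right hξ.2
  rw [projIcc_of_mem hab (hsub ht)]
  refine eqOn_truncRes hξ hu 1 hh.1 (fun t ht => ?_) ht
  rw [ContinuousMap.one_apply, ← hh.2 t ht]
  congr 1
  refine intervalIntegral.integral_congr fun s hs => ?_
  rw [uIcc_of_le hξ.1] at hs
  simp only [rightKernel_apply, Prod.swap_prod_mk, kernelMap_apply,
    coe_projIcc_of_mem hab (hsub hs)]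

theorem isTruncSolStar_truncRes (hξ : ξ ∈ Icc a b)
    (hu : IsUnit (1 - truncOp hab (rightKernel (kernelMap hK)) ξ)) :
    IsTruncSolStar K a ξ fun t =>
      truncRes hab (rightKernel (kernelMap hK)) ξ 1 (projIcc a b hab t) := by
  have hsub : Icc a ξ ⊆ Icc a b := Icc_subset_Icc_right hξ.2
  refine ⟨((ContinuousMap.continuous _).comp continuous_projIcc).continuousOn, fun t ht => ?_⟩
  refine Eq.trans ?_ (truncRes_apply_sub_integral hu 1 (projIcc a b hab t))
  congr 1
  refine intervalIntegral.integral_congr fun s hs => ?_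
  rw [uIcc_of_le hξ.1] at hs
  simp only [rightKernel_apply, Prod.swap_prod_mk, kernelMap_apply,
    coe_projIcc_of_mem hab (hsub hs), coe_projIcc_of_mem hab (hsub ht)]

theorem isSystemSol_truncRes {f : ℝ → Fin n → ℂ} {fc : C(Icc a b, Fin n → ℂ)}
    (hfc : ∀ t, fc t = f t)
    (hu : IsUnit (1 - truncOp hab (actKernel (mulVecL n) (kernelMap hK)) b)) :
    IsSystemSol K a b f fun t =>
      truncRes hab (actKernel (mulVecL n) (kernelMap hK)) b fc (projIcc a b hab t) := by
  refine ⟨((ContinuousMap.continuous _).comp continuous_projIcc).continuousOn, fun t ht => ?_⟩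
  rw [← coe_projIcc_of_mem hab ht, ← hfc, ← truncRes_apply_sub_integral hu fc,
    coe_projIcc_of_mem hab ht]
  congr 1
  refine intervalIntegral.integral_congr fun s hs => ?_
  rw [uIcc_of_le hab] at hs
  simp only [actKernel_apply, mulVecL_apply, kernelMap_apply,
    coe_projIcc_of_mem hab hs, coe_projIcc_of_mem hab ht]

theorem IsSystemSol.eq_truncRes {f ψ : ℝ → Fin n → ℂ} {fc : C(Icc a b, Fin n → ℂ)}
    (hfc : ∀ t, fc t = f t)
    (hu : IsUnit (1 - truncOp hab (actKernel (mulVecL n) (kernelMap hK)) b))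
    (hψ : IsSystemSol K a b f ψ) {t : ℝ} (ht : t ∈ Icc a b) :
    ψ t = truncRes hab (actKernel (mulVecL n) (kernelMap hK)) b fc (projIcc a b hab t) := by
  rw [projIcc_of_mem hab ht]
  refine eqOn_truncRes (right_mem_Icc.2 hab) hu fc hψ.1 (fun t ht => ?_) ht
  rw [hfc, ← hψ.2 t ht]
  congr 1
  refine intervalIntegral.integral_congr fun s hs => ?_
  rw [uIcc_of_le hab] at hs
  simp only [actKernel_apply, mulVecL_apply, kernelMap_apply, coe_projIcc_of_mem hab hs]

end Equations

/-! ### The derivatives of M and G, the function F, and the solution formula. -/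

section Formula

variable {n : ℕ} {a b : ℝ} {K : ℝ → ℝ → Matrix (Fin n) (Fin n) ℂ}
  {hK : ContinuousOn (fun p : ℝ × ℝ => K p.1 p.2) (Icc a b ×ˢ Icc a b)} {hab : a ≤ b}
  {g gs : ℝ → ℝ → Matrix (Fin n) (Fin n) ℂ}
  {f : ℝ → Fin n → ℂ} {fc : C(Icc a b, Fin n → ℂ)}

theorem isUnit_mulVecKernel {ξ : ℝ}
    (h : IsUnit (1 - truncOp hab (leftKernel (kernelMap hK)) ξ)) :
    IsUnit (1 - truncOp hab (actKernel (mulVecL n) (kernelMap hK)) ξ) :=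
  isUnit_one_sub_truncOp_actKernel columnsL_mulVecL columnsL_injective h

variable (hl : ∀ ξ ∈ Icc a b, IsUnit (1 - truncOp hab (leftKernel (kernelMap hK)) ξ))
  (hg : ∀ ξ ∈ Icc a b, IsTruncSol K a ξ (fun t => g t ξ))
  (hgs : ∀ ξ ∈ Icc a b, IsTruncSolStar K a ξ (fun t => gs t ξ))

include hl hg

/-- The derivative is taken within [t,b] because the equation determines g(t,η) only for η ≥ t. -/
theorem hasDerivWithinAt_truncSol {t ξ : ℝ} (ht : t ∈ Icc a b) (hξ : ξ ∈ Icc t b) :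
    HasDerivWithinAt (fun η => g t η)
      (resolventColumn hab (kernelMap hK) ξ (projIcc a b hab t) * g ξ ξ) (Icc t b) ξ := by
  have hsub : Icc t b ⊆ Icc a b := Icc_subset_Icc_left ht.1
  have h := hasDerivWithinAt_truncRes_leftKernel_apply hl 1 (projIcc a b hab t) (hsub hξ)
  have hξ' := hsub hξ
  rw [(hg ξ hξ').eq_truncRes hξ' (hl ξ hξ') (right_mem_Icc.2 hξ'.1)]
  exact (h.mono hsub).congr_of_mem (fun η hη =>
    (hg η (hsub hη)).eq_truncRes (hsub hη) (hl η (hsub hη)) ⟨ht.1, hη.1⟩) hξ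

theorem continuousOn_truncSol_diag : ContinuousOn (fun ξ => g ξ ξ) (Icc a b) :=
  (continuousOn_truncRes_diag hl 1).congr fun ξ hξ =>
    (hg ξ hξ).eq_truncRes hξ (hl ξ hξ) (right_mem_Icc.2 hξ.1)

omit hg in
theorem continuousOn_resolventColumn :
    ContinuousOn (resolventColumn hab (kernelMap hK)) (Icc a b) :=
  continuousOn_truncRes_apply hl
    (continuous_kernelSlice hab (leftKernel (kernelMap hK)) 1).continuousOn

include hgs

theorem hasDerivWithinAt_M {ξ : ℝ} (hξ : ξ ∈ Icc a b) :
    HasDerivWithinAt (M a g) (gs ξ ξ * g ξ ξ) (Icc a b) ξ := by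
  have h := hasDerivWithinAt_integral_truncRes_leftKernel hl 1 hξ
  have hr := isUnit_one_sub_truncOp_rightKernel hξ (hl ξ hξ)
  rw [(hg ξ hξ).eq_truncRes hξ (hl ξ hξ) (right_mem_Icc.2 hξ.1),
    (hgs ξ hξ).eq_truncRes hξ hr (right_mem_Icc.2 hξ.1)]
  refine h.congr_of_mem (fun η hη => ?_) hξ
  refine intervalIntegral.integral_congr fun t ht => ?_
  rw [uIcc_of_le hη.1] at ht
  exact (hg η hη).eq_truncRes hη (hl η hη) ht

variable (hlt : a < b)
include hlt

theorem M'_eq {ξ : ℝ} (hξ : ξ ∈ Icc a b) : M' a b g ξ = gs ξ ξ * g ξ ξ :=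
  (hasDerivWithinAt_M hl hg hgs hξ).derivWithin (uniqueDiffOn_Icc hlt ξ hξ)

variable (hfc : ∀ t, fc t = f t)
include hfc

omit hg hlt in
-- Duality rewrites G(η) as ∫_a^η φ_η, whose derivative is already known.
theorem hasDerivWithinAt_G {ξ : ℝ} (hξ : ξ ∈ Icc a b) :
    HasDerivWithinAt (G a gs f) (gs ξ ξ *ᵥ truncRes hab
      (actKernel (mulVecL n) (kernelMap hK)) ξ fc (projIcc a b hab ξ)) (Icc a b) ξ := by
  have hw : ∀ ξ ∈ Icc a b,
      IsUnit (1 - truncOp hab (actKernel (mulVecL n) (kernelMap hK)) ξ) :=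
    fun ξ hξ => isUnit_mulVecKernel (hl ξ hξ)
  have h := hasDerivWithinAt_integral_truncRes mulVecL_mul mulVecL_one hl hw fc hξ
  have hr : ∀ ξ ∈ Icc a b, IsUnit (1 - truncOp hab (rightKernel (kernelMap hK)) ξ) :=
    fun ξ hξ => isUnit_one_sub_truncOp_rightKernel hξ (hl ξ hξ)
  rw [(hgs ξ hξ).eq_truncRes hξ (hr ξ hξ) (right_mem_Icc.2 hξ.1)]
  refine h.congr_of_mem (fun η hη => ?_) hξ
  rw [← integral_act_truncRes_rightKernel mulVecL_mul mulVecL_one hη (hl η hη) (hw η hη)]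
  refine intervalIntegral.integral_congr fun t ht => ?_
  rw [uIcc_of_le hη.1] at ht
  have hta : t ∈ Icc a b := ⟨ht.1, ht.2.trans hη.2⟩
  simp only [mulVecL_apply, hfc, coe_projIcc_of_mem hab hta]
  rw [← (hgs η hη).eq_truncRes hη (hr η hη) ht]

variable (hdet : ∀ ξ ∈ Icc a b, (gs ξ ξ * g ξ ξ).det ≠ 0)
include hdet

/-- The factor g*(ξ,ξ) is common to M' and G' and cancels. -/
theorem F_eq {ξ : ℝ} (hξ : ξ ∈ Icc a b) :
    F a b g gs f ξ = (g ξ ξ)⁻¹ *ᵥ truncRes hab (actKernel (mulVecL n) (kernelMap hK)) ξ fc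
      (projIcc a b hab ξ) := by
  have hd := hdet ξ hξ
  rw [Matrix.det_mul] at hd
  have hgs' : IsUnit (gs ξ ξ).det := (left_ne_zero_of_mul hd).isUnit
  rw [F, M'_eq hl hg hgs hlt hξ, G',
    (hasDerivWithinAt_G hl hgs hfc hξ).derivWithin (uniqueDiffOn_Icc hlt ξ hξ),
    Matrix.mul_inv_rev, Matrix.mulVec_mulVec, Matrix.mul_assoc, Matrix.nonsing_inv_mul _ hgs',
    Matrix.mul_one]

theorem mulVec_F {ξ : ℝ} (hξ : ξ ∈ Icc a b) :
    g ξ ξ *ᵥ F a b g gs f ξ = truncRes hab (actKernel (mulVecL n) (kernelMap hK)) ξ fc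
      (projIcc a b hab ξ) := by
  have hd := hdet ξ hξ
  rw [Matrix.det_mul] at hd
  rw [F_eq hl hg hgs hlt hfc hdet hξ, Matrix.mulVec_mulVec,
    Matrix.mul_nonsing_inv _ (right_ne_zero_of_mul hd).isUnit, Matrix.one_mulVec]

theorem continuousOn_F : ContinuousOn (F a b g gs f) (Icc a b) := by
  have h1 : ContinuousOn (fun ξ => (g ξ ξ)⁻¹) (Icc a b) := fun ξ hξ => by
    have hd := hdet ξ hξ
    rw [Matrix.det_mul] at hd
    obtain ⟨x, hx⟩ := (Matrix.isUnit_iff_isUnit_det _).2 (right_ne_zero_of_mul hd).isUnit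
    simp only [Matrix.nonsing_inv_eq_ringInverse]
    have h2 : ContinuousAt Ring.inverse (g ξ ξ) := hx ▸ NormedRing.inverse_continuousAt x
    exact ContinuousAt.comp_continuousWithinAt (f := fun ξ => g ξ ξ) h2
      (continuousOn_truncSol_diag hl hg ξ hξ)
  have h3 : ContinuousOn (fun ξ => mulVecL n (g ξ ξ)⁻¹ (truncRes hab
      (actKernel (mulVecL n) (kernelMap hK)) ξ fc (projIcc a b hab ξ))) (Icc a b) :=
    ((mulVecL n).continuous.comp_continuousOn h1).clm_apply
      (continuousOn_truncRes_diag (fun ξ hξ => isUnit_mulVecKernel (hl ξ hξ)) fc)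
  exact h3.congr fun ξ hξ => F_eq hl hg hgs hlt hfc hdet hξ

/-- The resolvent solution in terms of `F`, with the integral in partially integrated form. -/
theorem truncRes_eq_sub {t : ℝ} (ht : t ∈ Icc a b) :
    truncRes hab (actKernel (mulVecL n) (kernelMap hK)) b fc (projIcc a b hab t) =
      g t b *ᵥ F a b g gs f b -
        ((mulVecL n (g t b) (F a b g gs f b) - mulVecL n (g t t) (F a b g gs f t)) -
          ∫ ξ in t..b, mulVecL n (resolventColumn hab (kernelMap hK) ξ (projIcc a b hab t)
            * g ξ ξ) (F a b g gs f ξ)) := by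
  set T := truncRes hab (actKernel (mulVecL n) (kernelMap hK)) with hT
  set γ := resolventColumn hab (kernelMap hK) with hγ
  have hw : ∀ ξ ∈ Icc a b,
      IsUnit (1 - truncOp hab (actKernel (mulVecL n) (kernelMap hK)) ξ) :=
    fun ξ hξ => isUnit_mulVecKernel (hl ξ hξ)
  have hderiv : ∀ ξ ∈ Icc a b, HasDerivWithinAt (fun η => T η fc (projIcc a b hab t))
      (mulVecL n (γ ξ (projIcc a b hab t)) (T ξ fc (projIcc a b hab ξ))) (Icc a b) ξ :=
    fun ξ hξ => hasDerivWithinAt_truncRes_actKernel_apply mulVecL_mul hl hw fc _ hξ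
  have hγc : ContinuousOn (fun ξ => γ ξ (projIcc a b hab t)) (Icc a b) :=
    (continuous_eval_const (projIcc a b hab t)).comp_continuousOn
      (continuousOn_resolventColumn hl)
  have hint := integral_eq_sub_of_hasDerivWithinAt_Icc hderiv
    (((mulVecL n).continuous.comp_continuousOn hγc).clm_apply (continuousOn_truncRes_diag hw fc))
    ht.1 ht.2 le_rfl
  -- Since g(ξ,ξ) F(ξ) = φ_ξ(ξ), the integrand ∂_ξ g(t,ξ) F(ξ) equals ∂_ξ φ_ξ(t), and its integral
  -- is φ_b(t) - φ_t(t).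
  have hcongr : ∫ ξ in t..b, mulVecL n (γ ξ (projIcc a b hab t) * g ξ ξ) (F a b g gs f ξ) =
      ∫ ξ in t..b, mulVecL n (γ ξ (projIcc a b hab t)) (T ξ fc (projIcc a b hab ξ)) := by
    refine intervalIntegral.integral_congr fun ξ hξ => ?_
    rw [uIcc_of_le ht.2] at hξ
    simp only [mulVecL_mul]
    rw [mulVecL_apply (g ξ ξ), mulVec_F hl hg hgs hlt hfc hdet ⟨ht.1.trans hξ.1, hξ.2⟩]
  rw [hcongr, hint, mulVecL_apply, mulVecL_apply, mulVec_F hl hg hgs hlt hfc hdet ht]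
  abel

omit hgs hlt hfc hdet in
theorem hasDerivWithinAt_mulVecL_truncSol {t : ℝ} (ht : t ∈ Icc a b) :
    (∀ ξ ∈ Icc t b, HasDerivWithinAt (fun ξ => mulVecL n (g t ξ))
      (mulVecL n (resolventColumn hab (kernelMap hK) ξ (projIcc a b hab t) * g ξ ξ))
      (Icc t b) ξ) ∧
    ContinuousOn (fun ξ => mulVecL n
      (resolventColumn hab (kernelMap hK) ξ (projIcc a b hab t) * g ξ ξ)) (Icc t b) := by
  refine ⟨fun ξ hξ => (mulVecL n).hasFDerivAt.comp_hasDerivWithinAt ξ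
    (hasDerivWithinAt_truncSol hl hg ht hξ), ?_⟩
  have hγc : ContinuousOn (fun ξ => resolventColumn hab (kernelMap hK) ξ
      (projIcc a b hab t)) (Icc a b) :=
    (continuous_eval_const (projIcc a b hab t)).comp_continuousOn
      (continuousOn_resolventColumn hl)
  exact ((mulVecL n).continuous.comp_continuousOn
    (hγc.mul (continuousOn_truncSol_diag hl hg))).mono (Icc_subset_Icc_left ht.1)

theorem exists_isStieltjesIntegral {t : ℝ} (ht : t ∈ Icc a b) :
    ∃ J : Fin n → ℂ, IsStieltjesIntegral (fun ξ => g t ξ) (F a b g gs f) t b J ∧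
      truncRes hab (actKernel (mulVecL n) (kernelMap hK)) b fc (projIcc a b hab t) =
        g t b *ᵥ F a b g gs f b - J := by
  obtain ⟨hA, hA'⟩ := hasDerivWithinAt_mulVecL_truncSol hl hg ht
  exact ⟨_, fun ε hε => exists_stieltjes_sum_lt ht.2 hA hA'
    ((continuousOn_F hl hg hgs hlt hfc hdet).mono (Icc_subset_Icc_left ht.1)) hε,
    truncRes_eq_sub hl hg hgs hlt hfc hdet ht⟩

theorem truncRes_eq_sub_integral_derivWithin
    (hF : AbsolutelyContinuousOnInterval (F a b g gs f) a b) {t : ℝ} (ht : t ∈ Icc a b) :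
    IntervalIntegrable (fun ξ => g t ξ *ᵥ derivWithin (F a b g gs f) (Icc a b) ξ) volume t b ∧
      truncRes hab (actKernel (mulVecL n) (kernelMap hK)) b fc (projIcc a b hab t) =
        g t b *ᵥ F a b g gs f b -
          ∫ ξ in t..b, g t ξ *ᵥ derivWithin (F a b g gs f) (Icc a b) ξ := by
  obtain ⟨hA, hA'⟩ := hasDerivWithinAt_mulVecL_truncSol hl hg ht
  have hFt : AbsolutelyContinuousOnInterval (F a b g gs f) t b := hF.mono (by
    rw [uIcc_of_le ht.2, uIcc_of_le hab]
    exact Icc_subset_Icc_left ht.1)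
  have hae : ∀ᵐ ξ : ℝ, ξ ∈ uIoc t b → mulVecL n (g t ξ) (deriv (F a b g gs f) ξ) =
      g t ξ *ᵥ derivWithin (F a b g gs f) (Icc a b) ξ := by
    -- Away from ξ = b the point is interior to [a,b], where one-sided and ordinary derivatives
    -- coincide.
    filter_upwards [Measure.ae_ne volume b] with ξ hξb hξ
    rw [uIoc_of_le ht.2] at hξ
    rw [mulVecL_apply, derivWithin_of_mem_nhds
      (Icc_mem_nhds (ht.1.trans_lt hξ.1) (lt_of_le_of_ne hξ.2 hξb))]
  have hint := hFt.intervalIntegrable_clm_apply_deriv ht.2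
    fun ξ hξ => (hA ξ hξ).continuousWithinAt
  refine ⟨hint.congr_ae ((ae_restrict_iff' measurableSet_uIoc).2 hae), ?_⟩
  rw [← intervalIntegral.integral_congr_ae hae, hFt.integral_clm_apply_deriv ht.2 hA hA']
  exact truncRes_eq_sub hl hg hgs hlt hfc hdet ht

end Formula

end KreinSystem

end

/-! ### The main theorem. -/

theorem theorem3p1 {n : ℕ} {a b : ℝ} (hab : a < b)
    (K : ℝ → ℝ → Matrix (Fin n) (Fin n) ℂ)
    (hK : ContinuousOn (fun p : ℝ × ℝ => K p.1 p.2) (Icc a b ×ˢ Icc a b))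
    (g : ℝ → ℝ → Matrix (Fin n) (Fin n) ℂ)
    (hg : ∀ ξ ∈ Icc a b, KreinSystem.IsTruncSol K a ξ (fun t => g t ξ))
    (hg_unique : ∀ ξ ∈ Ioc a b, ∀ h : ℝ → Matrix (Fin n) (Fin n) ℂ,
      KreinSystem.IsTruncSol K a ξ h → EqOn h (fun t => g t ξ) (Icc a ξ)) :
    -- the adjoint truncated equations are then uniquely solvable as well
    (∀ ξ ∈ Ioc a b, ∃ h : ℝ → Matrix (Fin n) (Fin n) ℂ, KreinSystem.IsTruncSolStar K a ξ h ∧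
      ∀ h' : ℝ → Matrix (Fin n) (Fin n) ℂ,
        KreinSystem.IsTruncSolStar K a ξ h' → EqOn h' h (Icc a ξ)) ∧
    ∀ gs : ℝ → ℝ → Matrix (Fin n) (Fin n) ℂ,
      (∀ ξ ∈ Icc a b, KreinSystem.IsTruncSolStar K a ξ (fun t => gs t ξ)) →
      (∀ ξ ∈ Icc a b, (gs ξ ξ * g ξ ξ).det ≠ 0) →
      -- `M` is differentiable with invertible derivative
      DifferentiableOn ℝ (KreinSystem.M a g) (Icc a b) ∧
      (∀ ξ ∈ Icc a b, IsUnit (KreinSystem.M' a b g ξ)) ∧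
      ∀ f : ℝ → Fin n → ℂ, ContinuousOn f (Icc a b) →
        DifferentiableOn ℝ (KreinSystem.G a gs f) (Icc a b) ∧
        ∃ φ : ℝ → Fin n → ℂ, KreinSystem.IsSystemSol K a b f φ ∧
          (∀ ψ : ℝ → Fin n → ℂ, KreinSystem.IsSystemSol K a b f ψ → EqOn ψ φ (Icc a b)) ∧
          -- the formula, with the outer derivative read in the Stieltjes sense
          (∀ t ∈ Icc a b, ∃ J : Fin n → ℂ,
            KreinSystem.IsStieltjesIntegral (fun ξ => g t ξ) (KreinSystem.F a b g gs f) t b J ∧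
            φ t = g t b *ᵥ ((KreinSystem.M' a b g b)⁻¹ *ᵥ KreinSystem.G' a b gs f b) - J) ∧
          -- the formula, with an honest outer derivative, whenever `F` is absolutely continuous
          (AbsolutelyContinuousOnInterval (KreinSystem.F a b g gs f) a b →
            (∀ᵐ ξ ∂(volume.restrict (Icc a b)),
              DifferentiableWithinAt ℝ (KreinSystem.F a b g gs f) (Icc a b) ξ) ∧
            ∀ t ∈ Icc a b,
              IntervalIntegrable
                (fun ξ => g t ξ *ᵥ derivWithin (KreinSystem.F a b g gs f) (Icc a b) ξ)
                volume t b ∧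
              φ t = g t b *ᵥ ((KreinSystem.M' a b g b)⁻¹ *ᵥ KreinSystem.G' a b gs f b)
                - ∫ ξ in t..b,
                    g t ξ *ᵥ derivWithin (KreinSystem.F a b g gs f) (Icc a b) ξ) := by
  have hl : ∀ ξ ∈ Icc a b, IsUnit
      (1 - KreinSystem.truncOp hab.le (KreinSystem.leftKernel (KreinSystem.kernelMap hK)) ξ) :=
    fun ξ hξ => KreinSystem.isUnit_leftKernel hK hab hg hg_unique hξ
  refine ⟨fun ξ hξ => ?_, fun gs hgs hdet => ⟨fun ξ hξ =>
    (KreinSystem.hasDerivWithinAt_M hl hg hgs hξ).differentiableWithinAt, fun ξ hξ => ?_,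
    fun f hf => ?_⟩⟩
  · have hξ' := Ioc_subset_Icc_self hξ
    have hr := KreinSystem.isUnit_one_sub_truncOp_rightKernel hξ' (hl ξ hξ')
    exact ⟨_, KreinSystem.isTruncSolStar_truncRes hξ' hr,
      fun h' hh' t ht => hh'.eq_truncRes hξ' hr ht⟩
  · rw [KreinSystem.M'_eq hl hg hgs hab hξ, Matrix.isUnit_iff_isUnit_det]
    exact (hdet ξ hξ).isUnit
  · let fc : C(Icc a b, Fin n → ℂ) := ⟨fun t => f t, hf.comp_continuous
      continuous_subtype_val fun t => t.2⟩
    have hfc : ∀ t, fc t = f t := fun _ => rfl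
    have hwb := KreinSystem.isUnit_mulVecKernel (hl b (right_mem_Icc.2 hab.le))
    -- The solution φ is R_b f, extended off [a,b] by projection.
    refine ⟨fun ξ hξ => (KreinSystem.hasDerivWithinAt_G hl hgs hfc hξ).differentiableWithinAt,
      _, KreinSystem.isSystemSol_truncRes hfc hwb,
      fun ψ hψ t ht => hψ.eq_truncRes hfc hwb ht,
      fun t ht => KreinSystem.exists_isStieltjesIntegral hl hg hgs hab hfc hdet ht,
      fun hF => ⟨?_, fun t ht =>
        KreinSystem.truncRes_eq_sub_integral_derivWithin hl hg hgs hab hfc hdet hF ht⟩⟩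
    rw [ae_restrict_iff' measurableSet_Icc]
    filter_upwards [hF.ae_differentiableAt_of_finiteDimensional] with ξ hξ hξm
    exact (hξ (uIcc_of_le hab.le ▸ hξm)).differentiableWithinAt
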